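/- Let $F$ be a non-archimedean local field with residue field of order $q$, $W_F$ its Weil group with its usual topology, and for $w\in W_F$ let $d(w)\in\mathbb Z$ be the exponent such that $w$ induces the $d(w)$-th power of the Frobenius automorphism $x\mapsto x^q$ on the residue field of the separable closure of $F$; put $\|w\|=q^{d(w)}$ and, for $s\in\mathbb C$, $\omega_s(w)=\|w\|^s$. Let $D$ be a central division algebra over $F$ of index $d$ (so $\dim_F D=d^2$), let $m\ge 1$ and $n=md$. The dual group of $GL_m(D)$ is $GL_n(\mathbb C)$, with trivial action of $W_F$. A Levi subgroup of $GL_n(\mathbb C)$ is called relevant for $GL_m(D)$ if it is conjugate to the dual group $GL_{c_1d}(\mathbb C)\times\cdots\times GL_{c_rd}(\mathbb C)$ (block diagonal) of a standard $F$-Levi subgroup $GL_{c_1}(D)\times\cdots\times GL_{c_r}(D)$ of $GL_m(D)$, where $c_i\ge1$ and $\sum_i c_i=m$. An L-homomorphism for $GL_m(D)$ is a homomorphism $\phi:SL_2(\mathbb C)\times W_F\to GL_n(\mathbb C)$ which is a rational morphism on $SL_2(\mathbb C)$, is continuous with semisimple values on $W_F$, and is such that every Levi subgroup of $GL_n(\mathbb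 C)$ containing the image of $\phi$ is relevant for $GL_m(D)$. The L-parameters $[\phi]\in\Phi(GL_m(D))$ are the classes of L-homomorphisms under conjugation by $GL_n(\mathbb C)$, and $[\phi]$ is tempered if $\phi(W_F)$ has compact closure in $GL_n(\mathbb C)$. Then the L-parameters $[\phi]\in\Phi(GL_m(D))$ are in bijection with all tuples $$\mathcal T=(m_1,\dots,m_{s+1};\ [{}^t\phi^{(1)}],\dots,[{}^t\phi^{(s+1)}];\ \beta_1>\cdots>\beta_{s+1})$$ where the $m_i\ge1$ are natural numbers with sum $m$, $[{}^t\phi^{(i)}]$ is a tempered L-parameter of $GL_{m_i}(D)$, and the $\beta_i$ are real numbers. The bijection sends $\mathcal T$ to the class of the block diagonal homomorphism $$(A,w)\mapsto \mathrm{diag}\bigl({}^t\phi^{(1)}(A,w)\,\omega_{\beta_1}(w),\dots,{}^t\phi^{(s+1)}(A,w)\,\omega_{\beta_{s+1}}(w)\bigr),$$ which is an L-homomorphism for $GL_m(D)$ for every choice of representatives ${}^t\phi^{(i)}\in[{}^t\phi^{(i)}]$. Moreover, the standard Levi subgroup of $GL_n(\mathbb C)$ with diagonal blocks of sizes $k_1,\dots,k_r\ge1$,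 $\sum_i k_i=n$, is relevant for $GL_m(D)$ if and only if every $k_i$ is a multiple of $d$. -/

import Mathlib

open scoped MatrixGroups

noncomputable section

namespace LanglandsGL

/-! ### The Weil group of a nonarchimedean local field

A nonarchimedean local field is a nontrivially normed, ultrametric, locally compact field `F`. -/

section Weil

variable (F : Type*) [NontriviallyNormedField F] [IsUltrametricDist F] [LocallyCompactSpace F]

/-- The order `q` of the residue field of `F`. -/
def residueCard : ℕ :=
  Nat.card (IsLocalRing.ResidueField (NormedField.valuation (K := F)).valuationSubring)

/-- The absolute Galois group of `F`, with its Krull topology. -/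
abbrev AbsGal : Type _ := SeparableClosure F ≃ₐ[F] SeparableClosure F

variable {F}

/-- `σ` induces on the residue field of the separable closure the `k`-th power of the Frobenius
automorphism `x ↦ x ^ q`. Writing `k = a - b` with natural numbers `a`, `b`, this says
`Frob ^ b ∘ σ = Frob ^ a` on residue classes of integral elements `x`; the spectral norm is the
unique extension of the absolute value of `F`. -/
def ActsAsFrobPow (σ : AbsGal F) (k : ℤ) : Prop :=
  ∃ a b : ℕ, k = (a : ℤ) - (b : ℤ) ∧ ∀ x : SeparableClosure F,
    spectralNorm F (SeparableClosure F) x ≤ 1 →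
      spectralNorm F (SeparableClosure F)
        (σ x ^ (residueCard F ^ b) - x ^ (residueCard F ^ a)) < 1

theorem spectralNorm_sep_mul (x y : SeparableClosure F) :
    spectralNorm F (SeparableClosure F) (x * y) =
      spectralNorm F (SeparableClosure F) x * spectralNorm F (SeparableClosure F) y := by
  have : ProperSpace F := .of_locallyCompactSpace F
  exact map_mul (spectralMulAlgNorm F (SeparableClosure F)) x y

theorem spectralNorm_sep_pow_le_one {x : SeparableClosure F}
    (hx : spectralNorm F (SeparableClosure F) x ≤ 1) (n : ℕ) :
    spectralNorm F (SeparableClosure F) (x ^ n) ≤ 1 := by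
  induction n with
  | zero => simpa using (spectralNorm_one (K := F) (L := SeparableClosure F)).le
  | succ n ih =>
    rw [pow_succ, spectralNorm_sep_mul]
    exact mul_le_one₀ ih (spectralNorm_nonneg _) hx

theorem spectralNorm_sep_add_lt_one {x y : SeparableClosure F}
    (hx : spectralNorm F (SeparableClosure F) x < 1)
    (hy : spectralNorm F (SeparableClosure F) y < 1) :
    spectralNorm F (SeparableClosure F) (x + y) < 1 :=
  (isNonarchimedean_spectralNorm x y).trans_lt (max_lt hx hy)

theorem spectralNorm_sep_pow_sub_pow {u v : SeparableClosure F}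
    (hu : spectralNorm F (SeparableClosure F) u ≤ 1)
    (hv : spectralNorm F (SeparableClosure F) v ≤ 1)
    (h : spectralNorm F (SeparableClosure F) (u - v) < 1) (n : ℕ) :
    spectralNorm F (SeparableClosure F) (u ^ n - v ^ n) < 1 := by
  induction n with
  | zero => simp [spectralNorm_zero]
  | succ n ih =>
    have e : u ^ (n + 1) - v ^ (n + 1) = u * (u ^ n - v ^ n) + (u - v) * v ^ n := by ring
    rw [e]
    apply spectralNorm_sep_add_lt_one
    · rw [spectralNorm_sep_mul]
      exact mul_lt_one_of_nonneg_of_lt_one_right hu (spectralNorm_nonneg _) ih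
    · rw [spectralNorm_sep_mul]
      exact mul_lt_one_of_nonneg_of_lt_one_left (spectralNorm_nonneg _) h
        (spectralNorm_sep_pow_le_one hv n)

theorem ActsAsFrobPow.one : ActsAsFrobPow (1 : AbsGal F) 0 :=
  ⟨0, 0, by simp, fun x _ ↦ by simp [spectralNorm_zero]⟩

theorem ActsAsFrobPow.mul {σ τ : AbsGal F} {k l : ℤ} (hσ : ActsAsFrobPow σ k)
    (hτ : ActsAsFrobPow τ l) : ActsAsFrobPow (σ * τ) (k + l) := by
  obtain ⟨a, b, rfl, h⟩ := hσ
  obtain ⟨a', b', rfl, h'⟩ := hτ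
  refine ⟨a + a', b + b', by push_cast; ring, fun x hx ↦ ?_⟩
  have hτx : spectralNorm F (SeparableClosure F) (τ x) ≤ 1 := by
    rw [← spectralNorm_eq_of_equiv τ x]; exact hx
  have hστx : spectralNorm F (SeparableClosure F) (σ (τ x)) ≤ 1 := by
    rw [← spectralNorm_eq_of_equiv σ (τ x)]; exact hτx
  have h1 := spectralNorm_sep_pow_sub_pow (spectralNorm_sep_pow_le_one hστx _)
    (spectralNorm_sep_pow_le_one hτx _) (h (τ x) hτx) (residueCard F ^ b')
  have h2 := spectralNorm_sep_pow_sub_pow (spectralNorm_sep_pow_le_one hτx _)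
    (spectralNorm_sep_pow_le_one hx _) (h' x hx) (residueCard F ^ a)
  have h3 := spectralNorm_sep_add_lt_one h1 h2
  simp only [← pow_mul, ← pow_add] at h3
  rw [add_comm b' a, add_comm a' a] at h3
  convert h3 using 2
  simp

theorem ActsAsFrobPow.inv {σ : AbsGal F} {k : ℤ} (hσ : ActsAsFrobPow σ k) :
    ActsAsFrobPow σ⁻¹ (-k) := by
  obtain ⟨a, b, rfl, h⟩ := hσ
  refine ⟨b, a, by ring, fun x hx ↦ ?_⟩
  have hx' : spectralNorm F (SeparableClosure F) (σ⁻¹ x) ≤ 1 := by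
    rw [← spectralNorm_eq_of_equiv σ⁻¹ x]; exact hx
  have h1 := h (σ⁻¹ x) hx'
  have e : σ (σ⁻¹ x) = x := σ.apply_symm_apply x
  rw [e] at h1
  rw [← neg_sub, spectralNorm_neg (Algebra.IsAlgebraic.isAlgebraic _)]
  exact h1

variable (F)

/-- The Weil group `W_F`, as the fibre product of the absolute Galois group and `ℤ` over the
absolute Galois group of the residue field (`1 ∈ ℤ` being sent to the Frobenius automorphism).
The second coordinate is determined by the first one, so that `W_F` is the group of all `σ` that
induce an integral power of Frobenius. The subspace topology of (Krull topology) × (discrete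
topology) is the usual topology of `W_F`: the inertia group is open and carries its
profinite topology. -/
def WeilGroup : Subgroup (AbsGal F × Multiplicative ℤ) where
  carrier := {g | ActsAsFrobPow g.1 g.2.toAdd}
  one_mem' := ActsAsFrobPow.one
  mul_mem' h h' := h.mul h'
  inv_mem' h := h.inv

variable {F}

/-- The exponent `d(w)`: `w` acts on residues as the `d(w)`-th power of Frobenius. -/
def weilDegree (w : WeilGroup F) : ℤ := w.1.2.toAdd

/-- `‖w‖ = q ^ d(w)`. -/
def weilNorm (w : WeilGroup F) : ℝ := (residueCard F : ℝ) ^ weilDegree w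

theorem finite_residueField :
    Finite (IsLocalRing.ResidueField (NormedField.valuation (K := F)).valuationSubring) := by
  have : ProperSpace F := .of_locallyCompactSpace F
  obtain ⟨t, -, ht, hcov⟩ := (isCompact_closedBall (0 : F) 1).finite_cover_balls one_pos
  have : Finite t := ht
  have key : ∀ y : IsLocalRing.ResidueField (NormedField.valuation (K := F)).valuationSubring,
      ∃ x : t, ∃ z : (NormedField.valuation (K := F)).valuationSubring,
        IsLocalRing.residue _ z = y ∧ ‖(z : F) - x‖ < 1 := by
    intro y
    obtain ⟨z, rfl⟩ := IsLocalRing.residue_surjective y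
    have hz : ‖(z : F)‖ ≤ 1 := z.2
    have hz' : (z : F) ∈ Metric.closedBall (0 : F) 1 := by simpa using hz
    obtain ⟨x, hx, hxz⟩ := Set.mem_iUnion₂.mp (hcov hz')
    exact ⟨⟨x, hx⟩, z, rfl, by simpa [dist_eq_norm] using hxz⟩
  choose f g hg hfg using key
  refine Finite.of_injective f fun y y' hyy ↦ ?_
  rw [← hg y, ← hg y', ← sub_eq_zero, ← map_sub, IsLocalRing.residue_eq_zero_iff,
    IsLocalRing.mem_maximalIdeal, mem_nonunits_iff]
  have h1 := hfg y
  have h2 := hfg y'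
  rw [← hyy, norm_sub_rev] at h2
  have h3 : ‖((g y - g y' : (NormedField.valuation (K := F)).valuationSubring) : F)‖ < 1 := by
    have e : ((g y - g y' : (NormedField.valuation (K := F)).valuationSubring) : F) =
        ((g y : F) - f y) + ((f y : F) - g y') := by push_cast; ring
    rw [e]
    exact (IsUltrametricDist.norm_add_le_max _ _).trans_lt (max_lt h1 h2)
  intro hu
  obtain ⟨v, hv⟩ := hu.exists_right_inv
  have hv1 : ‖(v : F)‖ ≤ 1 := v.2
  have h4 : ((g y - g y' : (NormedField.valuation (K := F)).valuationSubring) : F) * (v : F) = 1 :=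
    congrArg Subtype.val hv
  have h5 := congrArg norm h4
  rw [norm_mul, norm_one] at h5
  exact (mul_lt_one_of_nonneg_of_lt_one_left (norm_nonneg _) h3 hv1).ne h5

theorem residueCard_pos : 0 < residueCard F := by
  have := finite_residueField (F := F)
  exact Nat.card_pos

theorem weilNorm_pos (w : WeilGroup F) : 0 < weilNorm w :=
  zpow_pos (by exact_mod_cast residueCard_pos) _

theorem weilNorm_mul (w w' : WeilGroup F) : weilNorm (w * w') = weilNorm w * weilNorm w' :=
  zpow_add₀ (by exact_mod_cast (residueCard_pos (F := F)).ne') _ _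

/-- The unramified character `ω_s : w ↦ ‖w‖ ^ s` of the Weil group. -/
def omega (s : ℂ) : WeilGroup F →* ℂˣ where
  toFun w := Units.mk0 ((weilNorm w : ℂ) ^ s)
    (by simp [Complex.cpow_eq_zero_iff, (weilNorm_pos w).ne'])
  map_one' := by
    ext
    simp [weilNorm, weilDegree]
  map_mul' w w' := by
    ext
    simp [weilNorm_mul, Complex.mul_cpow_ofReal_nonneg (weilNorm_pos w).le (weilNorm_pos w').le]

end Weil

/-! ### Levi subgroups of `GL_n(ℂ)` -/

/-- The embedding `GL_{k_1}(ℂ) × ⋯ × GL_{k_r}(ℂ) → GL_n(ℂ)`, `n = k_1 + ⋯ + k_r`, as block diagonal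
matrices with consecutive diagonal blocks. -/
def blockDiag {r n : ℕ} (k : Fin r → ℕ) (h : ∑ i, k i = n) :
    (∀ i, GL (Fin (k i)) ℂ) →* GL (Fin n) ℂ :=
  (Units.map ((Matrix.reindexRingEquiv ℂ
      (finSigmaFinEquiv.trans (finCongr h))).toRingHom.comp
        (Matrix.blockDiagonal'RingHom (fun i ↦ Fin (k i)) ℂ)).toMonoidHom).comp
    (MulEquiv.piUnits.symm).toMonoidHom

/-- The standard Levi subgroup of block diagonal matrices with block sizes `k_1, …, k_r`. -/
def standardLevi {r n : ℕ} (k : Fin r → ℕ) (h : ∑ i, k i = n) : Subgroup (GL (Fin n) ℂ) :=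
  (blockDiag k h).range

/-- The conjugate `g H g⁻¹`. -/
def conjSubgroup {n : ℕ} (g : GL (Fin n) ℂ) (H : Subgroup (GL (Fin n) ℂ)) :
    Subgroup (GL (Fin n) ℂ) :=
  H.map (MulAut.conj g).toMonoidHom

/-- Levi subgroups of `GL_n(ℂ)`: the conjugates of the standard ones. -/
def IsLevi {n : ℕ} (L : Subgroup (GL (Fin n) ℂ)) : Prop :=
  ∃ (r : ℕ) (k : Fin r → ℕ) (_ : ∀ i, 1 ≤ k i) (h : ∑ i, k i = n) (g : GL (Fin n) ℂ),
    L = conjSubgroup g (standardLevi k h)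

theorem sum_mul_eq {r m : ℕ} {c : Fin r → ℕ} (h : ∑ i, c i = m) (d : ℕ) :
    ∑ i, c i * d = m * d := by
  rw [← Finset.sum_mul, h]

/-! ### L-parameters of `GL_m(D)` -/

section Parameters

variable (F : Type*) [NontriviallyNormedField F] [IsUltrametricDist F] [LocallyCompactSpace F]
variable (D : Type*) [DivisionRing D] [Algebra F D]

/-- The index `d` of a central division algebra `D` over `F`: `d ^ 2 = dim_F D`. -/
def index : ℕ := Nat.sqrt (Module.finrank F D)

/-- The dual group of `GL_m(D)` is `GL_n(ℂ)` with `n = m * d`, and the Weil group acts trivially on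
it. The standard `F`-Levi subgroup `GL_{c_1}(D) × ⋯ × GL_{c_r}(D)` of `GL_m(D)`, where
`c_1 + ⋯ + c_r = m`, has as its dual group the standard Levi subgroup
`GL_{c_1 * d}(ℂ) × ⋯ × GL_{c_r * d}(ℂ)`. A Levi subgroup of `GL_n(ℂ)` is relevant for `GL_m(D)` if
it is conjugate to such a dual group. -/
def IsRelevantLevi (m : ℕ) (L : Subgroup (GL (Fin (m * index F D)) ℂ)) : Prop :=
  ∃ (r : ℕ) (c : Fin r → ℕ) (_ : ∀ i, 1 ≤ c i) (h : ∑ i, c i = m)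
    (g : GL (Fin (m * index F D)) ℂ),
    L = conjSubgroup g (standardLevi (fun i ↦ c i * index F D) (sum_mul_eq h _))

variable {F} in
/-- The twist `(A, w) ↦ χ(w) φ(A, w)` of a homomorphism by a character of the Weil group. -/
def twist {n : ℕ} (φ : SL(2, ℂ) × WeilGroup F →* GL (Fin n) ℂ) (χ : WeilGroup F →* ℂˣ) :
    SL(2, ℂ) × WeilGroup F →* GL (Fin n) ℂ where
  toFun g := Matrix.GeneralLinearGroup.scalar (Fin n) (χ g.2) * φ g
  map_one' := by simp
  map_mul' g h := by
    simp only [Prod.snd_mul, map_mul]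
    rw [mul_assoc, mul_assoc, ← mul_assoc (φ g),
      ← Matrix.GeneralLinearGroup.scalar_commute (χ h.2) (φ g), mul_assoc]

variable {F} in
/-- The condition that a homomorphism `φ : SL₂(ℂ) × W_F → GL_n(ℂ)`, `n = m * d`, is an
L-homomorphism for `GL_m(D)`: it is rational on `SL₂(ℂ)`, continuous with semisimple values on
`W_F`, and every Levi subgroup of `GL_n(ℂ)` that contains its image is relevant. -/
structure IsLHom (m : ℕ) (φ : SL(2, ℂ) × WeilGroup F →* GL (Fin (m * index F D)) ℂ) : Prop where
  rational : ∀ i j, ∃ P : MvPolynomial (Fin 2 × Fin 2) ℂ, ∀ A : SL(2, ℂ),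
    (φ (A, 1)).val i j = MvPolynomial.eval (fun p ↦ A.val p.1 p.2) P
  continuous : Continuous fun w : WeilGroup F ↦ φ (1, w)
  semisimple : ∀ w : WeilGroup F, Module.End.IsSemisimple (Matrix.toLin' (φ (1, w)).val)
  relevant : ∀ L, IsLevi L → φ.range ≤ L → IsRelevantLevi F D m L

/-- L-homomorphisms for `GL_m(D)`. -/
def LHom (m : ℕ) : Type _ :=
  {φ : SL(2, ℂ) × WeilGroup F →* GL (Fin (m * index F D)) ℂ // IsLHom D m φ}

/-- Equivalence of L-homomorphisms: conjugation by an element of the dual group. -/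
instance lHomSetoid (m : ℕ) : Setoid (LHom F D m) where
  r φ ψ := ∃ x : GL (Fin (m * index F D)) ℂ, ∀ g, ψ.1 g = x * φ.1 g * x⁻¹
  iseqv :=
    { refl := fun φ ↦ ⟨1, fun g ↦ by simp⟩
      symm := by
        rintro φ ψ ⟨x, hx⟩
        exact ⟨x⁻¹, fun g ↦ by rw [hx g]; group⟩
      trans := by
        rintro φ ψ χ ⟨x, hx⟩ ⟨y, hy⟩
        exact ⟨y * x, fun g ↦ by rw [hy g, hx g]; group⟩ }

/-- The set `Φ(GL_m(D))` of L-parameters: equivalence classes of L-homomorphisms. -/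
def LParameter (m : ℕ) : Type _ := Quotient (lHomSetoid F D m)

variable {F D}

/-- The L-parameter `[φ]` of an L-homomorphism. -/
def LHom.toParameter {m : ℕ} (φ : LHom F D m) : LParameter F D m := Quotient.mk _ φ

/-- `φ` is tempered if the image of the Weil group has compact closure in the dual group. -/
def LHom.IsTempered {m : ℕ} (φ : LHom F D m) : Prop :=
  IsCompact (closure (Set.range fun w : WeilGroup F ↦ φ.1 (1, w)))

theorem LHom.IsTempered.of_equiv {m : ℕ} {φ ψ : LHom F D m} (h : φ ≈ ψ) (hφ : φ.IsTempered) :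
    ψ.IsTempered := by
  obtain ⟨x, hx⟩ := h
  let c : GL (Fin (m * index F D)) ℂ ≃ₜ GL (Fin (m * index F D)) ℂ :=
    (Homeomorph.mulLeft x).trans (Homeomorph.mulRight x⁻¹)
  have e : (Set.range fun w : WeilGroup F ↦ ψ.1 (1, w)) =
      c '' (Set.range fun w : WeilGroup F ↦ φ.1 (1, w)) := by
    rw [← Set.range_comp]
    congr 1
    funext w
    exact hx (1, w)
  unfold LHom.IsTempered at *
  rw [e, ← c.image_closure]
  exact hφ.image c.continuous

/-- Temperedness of an L-parameter. -/
def LParameter.IsTempered {m : ℕ} (p : LParameter F D m) : Prop :=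
  Quotient.lift LHom.IsTempered
    (fun _ _ h ↦ propext ⟨fun k ↦ k.of_equiv h, fun k ↦ k.of_equiv (Setoid.symm h)⟩) p

variable (F D)

/-- The tuples `(m_1, …, m_r; [φ^(1)], …, [φ^(r)]; β_1 > ⋯ > β_r)` with `m_i ≥ 1` of sum `m`,
tempered L-parameters `[φ^(i)]` of `GL_{m_i}(D)` and real numbers `β_i`. -/
structure LanglandsTuple (m : ℕ) where
  length : ℕ
  size : Fin length → ℕ
  size_pos : ∀ i, 1 ≤ size i
  size_sum : ∑ i, size i = m
  param : ∀ i, LParameter F D (size i)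
  tempered : ∀ i, (param i).IsTempered
  exponent : Fin length → ℝ
  exponent_anti : StrictAnti exponent

variable {F D}

/-- The block diagonal homomorphism with diagonal blocks `φ^(i) ω_{β_i}`. -/
def twistedBlockSum {m : ℕ} (T : LanglandsTuple F D m) (φ : ∀ i, LHom F D (T.size i)) :
    SL(2, ℂ) × WeilGroup F →* GL (Fin (m * index F D)) ℂ :=
  (blockDiag (fun i ↦ T.size i * index F D) (sum_mul_eq T.size_sum _)).comp
    (MonoidHom.pi fun i ↦ twist (φ i).1 (omega (T.exponent i : ℂ)))

end Parameters

end LanglandsGL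

end

set_option linter.unusedSectionVars false

/-! On the Weil group a homomorphism `φ` is controlled, up to bounded factors, by one Frobenius
element `w₀`: every `w` is `w₀ ^ d(w)` times an element of the compact inertia group. For real `β`
let `growthSpace φ β` consist of the vectors `v` with `‖φ(1, w) v‖ = O(‖w‖ ^ β)`, for all `w` of
positive and negative degree. As `φ(1, w₀)` is diagonalizable, this is the sum of its eigenspaces
for the eigenvalues of absolute value `q ^ β` (`growthSpace_eq_iSup`), so `ℂ ^ n` is the direct sum
of the growth spaces. They are invariant under `SL₂(ℂ) × W_F`. In an adapted basis `φ` is block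
diagonal, and each block is `ω_β` times a homomorphism that is bounded on `W_F`, that is, tempered
(`exists_conj_twistedSum`).

Uniqueness: in a sum of twists of bounded homomorphisms with distinct exponents the growth spaces
are the blocks, and an intertwining matrix respects growth (`exponent_eq_of_intertwining`). A
conjugating matrix therefore matches the exponents and the block sizes; it is then block diagonal
and conjugates each summand separately.

Relevance is a condition on traces: all Levi subgroups containing the image of `φ` are relevant
exactly when every idempotent commuting with `φ` has trace divisible by `d`
(`forall_isRelevantLevi_iff`). This condition is stable under conjugation and twisting and passes to
summands. It also passes from the summands to a twisted sum of bounded homomorphisms with distinct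
exponents, because the idempotents commuting with such a sum are block diagonal. The same invariant,
applied to the block projections, shows that a relevant standard Levi subgroup has block sizes
divisible by `d`. -/

noncomputable section

namespace LanglandsGL

/-! ### Frobenius elements, compactness of inertia, unramified characters -/

section Weil

variable (F : Type*) [NontriviallyNormedField F] [IsUltrametricDist F] [LocallyCompactSpace F]

/-- The ring of integers of the separable closure of `F`. -/
def sepIntegers : Subring (SeparableClosure F) where
  carrier := {x | spectralNorm F (SeparableClosure F) x ≤ 1}
  mul_mem' {x y} hx hy := by
    simp only [Set.mem_ofPred_eq] at *
    rw [spectralNorm_sep_mul]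
    exact mul_le_one₀ hx (spectralNorm_nonneg _) hy
  one_mem' := (spectralNorm_one (K := F) (L := SeparableClosure F)).le
  add_mem' hx hy := (isNonarchimedean_spectralNorm _ _).trans (max_le hx hy)
  zero_mem' := by simp [spectralNorm_zero]
  neg_mem' {x} hx := by
    simp only [Set.mem_ofPred_eq] at *
    rwa [spectralNorm_neg (Algebra.IsAlgebraic.isAlgebraic _)]

/-- The maximal ideal of the ring of integers of the separable closure of `F`. -/
def sepMaxIdeal : Ideal (sepIntegers F) where
  carrier := {x | spectralNorm F (SeparableClosure F) x < 1}
  add_mem' hx hy := spectralNorm_sep_add_lt_one hx hy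
  zero_mem' := by simp [spectralNorm_zero]
  smul_mem' c x hx := by
    simp only [Set.mem_ofPred_eq, smul_eq_mul, Subring.coe_mul] at *
    rw [spectralNorm_sep_mul]
    exact mul_lt_one_of_nonneg_of_lt_one_right c.2 (spectralNorm_nonneg _) hx

variable {F}

theorem mem_sepIntegers {x : SeparableClosure F} :
    x ∈ sepIntegers F ↔ spectralNorm F (SeparableClosure F) x ≤ 1 := Iff.rfl

theorem mem_sepMaxIdeal {x : sepIntegers F} :
    x ∈ sepMaxIdeal F ↔ spectralNorm F (SeparableClosure F) x < 1 := Iff.rfl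

instance : (sepMaxIdeal F).IsPrime := by
  refine Ideal.isPrime_iff.2 ⟨fun h ↦ ?_, fun {x y} h ↦ ?_⟩
  · have := mem_sepMaxIdeal.1 ((Ideal.eq_top_iff_one _).1 h)
    exact this.ne (spectralNorm_one (K := F) (L := SeparableClosure F))
  · simp only [mem_sepMaxIdeal] at *
    by_contra! hc
    have h1 := le_antisymm (mem_sepIntegers.1 x.2) hc.1
    have h2 := le_antisymm (mem_sepIntegers.1 y.2) hc.2
    rw [Subring.coe_mul, spectralNorm_sep_mul, h1, h2] at h
    norm_num at h

instance : IsInvariantSubring (AbsGal F) (sepIntegers F) where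
  smul_mem σ x hx := by
    rw [mem_sepIntegers] at *
    rwa [AlgEquiv.smul_def, ← spectralNorm_eq_of_equiv σ x]

theorem coe_smul_sepIntegers (σ : AbsGal F) (x : sepIntegers F) :
    ((σ • x : sepIntegers F) : SeparableClosure F) = σ x := rfl

theorem mem_valuationSubring {x : F} :
    x ∈ (NormedField.valuation (K := F)).valuationSubring ↔ ‖x‖ ≤ 1 := Iff.rfl

theorem mem_maximalIdeal_valuationSubring
    {x : (NormedField.valuation (K := F)).valuationSubring} :
    x ∈ IsLocalRing.maximalIdeal (NormedField.valuation (K := F)).valuationSubring ↔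
      ‖(x : F)‖ < 1 := by
  rw [IsLocalRing.mem_maximalIdeal, mem_nonunits_iff]
  constructor
  · intro h
    by_contra! hc
    apply h
    have h1 : ‖(x : F)‖ = 1 := le_antisymm x.2 hc
    have h0 : (x : F) ≠ 0 := by
      rw [← norm_ne_zero_iff, h1]; exact one_ne_zero
    exact IsUnit.of_mul_eq_one
      (⟨(x : F)⁻¹, by rw [mem_valuationSubring, norm_inv, h1, inv_one]⟩ :
        (NormedField.valuation (K := F)).valuationSubring)
      (Subtype.ext (mul_inv_cancel₀ h0))
  · intro h3 hu
    obtain ⟨v, hv⟩ := hu.exists_right_inv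
    have hv1 : ‖(v : F)‖ ≤ 1 := v.2
    have h4 : (x : F) * (v : F) = 1 := congrArg Subtype.val hv
    have h5 := congrArg norm h4
    rw [norm_mul, norm_one] at h5
    exact (mul_lt_one_of_nonneg_of_lt_one_left (norm_nonneg _) h3 hv1).ne h5

instance sepIntegersAlgebra :
    Algebra (NormedField.valuation (K := F)).valuationSubring (sepIntegers F) :=
  RingHom.toAlgebra (((algebraMap F (SeparableClosure F)).comp
    (NormedField.valuation (K := F)).valuationSubring.subtype).codRestrict (sepIntegers F)
      fun x ↦ by
        have : ProperSpace F := .of_locallyCompactSpace F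
        rw [mem_sepIntegers]
        exact (spectralNorm_extends (x : F)).trans_le x.2)

theorem coe_algebraMap_sepIntegers (x : (NormedField.valuation (K := F)).valuationSubring) :
    ((algebraMap _ (sepIntegers F) x : sepIntegers F) : SeparableClosure F) =
      algebraMap F (SeparableClosure F) x := rfl

instance : (sepMaxIdeal F).LiesOver
    (IsLocalRing.maximalIdeal (NormedField.valuation (K := F)).valuationSubring) :=
  ⟨by
    ext x
    rw [mem_maximalIdeal_valuationSubring, Ideal.under_def, Ideal.mem_comap, mem_sepMaxIdeal,
      coe_algebraMap_sepIntegers, spectralNorm_extends]⟩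

instance : SMulCommClass (AbsGal F) (NormedField.valuation (K := F)).valuationSubring
    (sepIntegers F) where
  smul_comm σ a x := by
    ext
    simp only [Algebra.smul_def, smul_mul', Subring.coe_mul]
    congr 1
    rw [coe_smul_sepIntegers, coe_algebraMap_sepIntegers, AlgEquiv.commutes]

/-- An element fixed by the whole Galois group lies in `F`, and the spectral norm extends the norm
of `F`. -/
instance : Algebra.IsInvariant (NormedField.valuation (K := F)).valuationSubring
    (sepIntegers F) (AbsGal F) where
  isInvariant b hb := by
    obtain ⟨a, ha⟩ := (InfiniteGalois.mem_range_algebraMap_iff_fixed (k := F)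
      (b : SeparableClosure F)).2 fun σ ↦ by
        rw [← coe_smul_sepIntegers, hb]
    refine ⟨⟨a, ?_⟩, Subtype.ext ?_⟩
    · rw [mem_valuationSubring, ← spectralNorm_extends (L := SeparableClosure F), ha]
      exact b.2
    · exact ha

/-- For the discrete topology, continuity of the Galois action means that stabilizers are open. This
is the setting of the results on residue extensions for profinite groups. -/
instance : TopologicalSpace (sepIntegers F) := ⊥

instance : DiscreteTopology (sepIntegers F) := ⟨rfl⟩

instance : ContinuousSMul (AbsGal F) (sepIntegers F) := by
  refine continuousSMul_iff_stabilizer_isOpen.2 fun x ↦ ?_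
  convert stabilizer_isOpen_of_isIntegral (K := F) (x : SeparableClosure F) using 1
  ext σ
  simp only [SetLike.mem_coe, MulAction.mem_stabilizer_iff]
  rw [Subtype.ext_iff]
  rfl

instance : Algebra.IsIntegral (NormedField.valuation (K := F)).valuationSubring
    (sepIntegers F) :=
  Algebra.IsInvariant.isIntegral_of_profinite (G := AbsGal F)

variable (F) in
/-- A Frobenius element exists. -/
theorem exists_actsAsFrobPow_one : ∃ σ : AbsGal F, ActsAsFrobPow σ 1 := by
  let A := (NormedField.valuation (K := F)).valuationSubring
  let P : Ideal A := IsLocalRing.maximalIdeal A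
  let Q := sepMaxIdeal F
  have : Q.IsMaximal := Ideal.isMaximal_of_isIntegral_of_isMaximal_comap (R := A) Q (by
    have h := Ideal.LiesOver.over (p := P) (P := Q)
    rw [Ideal.under_def] at h
    rw [← h]
    infer_instance)
  have hfin : Finite (A ⧸ P) := finite_residueField (F := F)
  let _ : Field (A ⧸ P) := Ideal.Quotient.field P
  let _ : Field (sepIntegers F ⧸ Q) := Ideal.Quotient.field Q
  let _ : Fintype (A ⧸ P) := Fintype.ofFinite _
  have hint : Algebra.IsIntegral (A ⧸ P) (sepIntegers F ⧸ Q) :=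
    Ideal.Quotient.algebra_isIntegral_of_liesOver Q P
  have halg : Algebra.IsAlgebraic (A ⧸ P) (sepIntegers F ⧸ Q) := hint.isAlgebraic
  -- The decomposition group of `Q` surjects onto the automorphisms of the residue extension, so the
  -- Frobenius automorphism lifts.
  obtain ⟨σ, hσ⟩ := Ideal.Quotient.stabilizerHom_surjective_of_profinite (G := AbsGal F) P Q
    (FiniteField.frobeniusAlgEquivOfAlgebraic (A ⧸ P) (sepIntegers F ⧸ Q))
  refine ⟨σ, 1, 0, by simp, fun x hx ↦ ?_⟩
  have h1 := DFunLike.congr_fun hσ (Ideal.Quotient.mk Q ⟨x, hx⟩)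
  have h2 : Ideal.Quotient.mk Q (σ.1 • ⟨x, hx⟩ : sepIntegers F) =
      Ideal.Quotient.mk Q (⟨x, hx⟩ ^ residueCard F) := by
    rw [map_pow]
    refine Eq.trans ?_ (h1.trans ?_)
    · rfl
    · rw [FiniteField.coe_frobeniusAlgEquivOfAlgebraic, ← Nat.card_eq_fintype_card]
      rfl
  rw [Ideal.Quotient.eq, mem_sepMaxIdeal] at h2
  simp only [AddSubgroupClass.coe_sub, coe_smul_sepIntegers, SubmonoidClass.coe_pow] at h2
  simpa using h2

variable (F) in
theorem exists_weilDegree_eq_one : ∃ w : WeilGroup F, weilDegree w = 1 := by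
  obtain ⟨σ, hσ⟩ := exists_actsAsFrobPow_one F
  exact ⟨⟨(σ, Multiplicative.ofAdd 1), hσ⟩, rfl⟩

/-- The automorphisms in the kernel of the degree are those that act trivially on residues. -/
theorem actsAsFrobPow_zero_iff {σ : AbsGal F} :
    ActsAsFrobPow σ 0 ↔ ∀ x : sepIntegers F, σ • x - x ∈ sepMaxIdeal F := by
  constructor
  · rintro ⟨a, b, hab, h⟩ x
    obtain rfl : a = b := by omega
    let A := (NormedField.valuation (K := F)).valuationSubring
    let P : Ideal A := IsLocalRing.maximalIdeal A
    have hfin : Finite (A ⧸ P) := finite_residueField (F := F)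
    let _ : Field (A ⧸ P) := Ideal.Quotient.field P
    let _ : Fintype (A ⧸ P) := Fintype.ofFinite _
    have hcard : Fintype.card (A ⧸ P) = residueCard F := (Nat.card_eq_fintype_card).symm
    let f := (FiniteField.frobeniusAlgHom (A ⧸ P) (sepIntegers F ⧸ sepMaxIdeal F)) ^ a
    have hf : ∀ y, f y = y ^ residueCard F ^ a := fun y ↦ by
      simp only [f]
      rw [AlgHom.coe_pow, FiniteField.coe_frobeniusAlgHom, pow_iterate, hcard]
    have h1 : Ideal.Quotient.mk (sepMaxIdeal F) ((σ • x) ^ residueCard F ^ a) =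
        Ideal.Quotient.mk (sepMaxIdeal F) (x ^ residueCard F ^ a) := by
      rw [Ideal.Quotient.eq, mem_sepMaxIdeal]
      exact h x x.2
    -- The `q ^ a`-power map is additive on the residue ring, so the class of `σ • x - x` is
    -- nilpotent; it vanishes because `sepMaxIdeal F` is prime.
    rw [map_pow, map_pow, ← hf, ← hf, ← sub_eq_zero, ← map_sub, hf] at h1
    rw [← Ideal.Quotient.eq_zero_iff_mem, map_sub]
    exact eq_zero_of_pow_eq_zero h1
  · intro h
    refine ⟨0, 0, by simp, fun x hx ↦ ?_⟩
    have h2 := mem_sepMaxIdeal.1 (h ⟨x, hx⟩)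
    simp only [AddSubgroupClass.coe_sub, coe_smul_sepIntegers] at h2
    simpa using h2

variable (F) in
-- For each integral `x` the condition involves only `σ • x`, which depends continuously on `σ` and
-- lies in a discrete space.
theorem isClosed_setOf_actsAsFrobPow_zero : IsClosed {σ : AbsGal F | ActsAsFrobPow σ 0} := by
  simp only [actsAsFrobPow_zero_iff, Set.ofPred_forall]
  refine isClosed_iInter fun x ↦ ?_
  have hc : Continuous fun σ : AbsGal F ↦ σ • x - x :=
    (continuous_of_discreteTopology (f := fun y : sepIntegers F ↦ y - x)).comp
      (continuous_id.smul continuous_const)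
  exact (isClosed_discrete (sepMaxIdeal F : Set (sepIntegers F))).preimage hc

variable (F) in
/-- The inertia group is compact. -/
theorem isCompact_inertia : IsCompact {w : WeilGroup F | weilDegree w = 0} := by
  rw [Subtype.isCompact_iff]
  have : ((↑) : WeilGroup F → AbsGal F × Multiplicative ℤ) '' {w | weilDegree w = 0} =
      (fun σ ↦ (σ, 1)) '' {σ : AbsGal F | ActsAsFrobPow σ 0} := by
    ext ⟨σ, k⟩
    constructor
    · rintro ⟨⟨⟨τ, l⟩, h⟩, hw, he⟩
      obtain ⟨rfl, rfl⟩ := Prod.mk.inj he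
      have hk : l.toAdd = 0 := hw
      have h' : ActsAsFrobPow τ l.toAdd := h
      rw [hk] at h'
      exact ⟨τ, h', Prod.ext rfl (toAdd_eq_zero.1 hk).symm⟩
    · rintro ⟨τ, h, he⟩
      exact ⟨⟨(τ, 1), h⟩, rfl, he⟩
  rw [this]
  exact (isClosed_setOf_actsAsFrobPow_zero F).isCompact.image (by fun_prop)

theorem continuous_weilNorm : Continuous (weilNorm : WeilGroup F → ℝ) := by
  have : (weilNorm : WeilGroup F → ℝ) =
      (fun k : Multiplicative ℤ ↦ (residueCard F : ℝ) ^ k.toAdd) ∘ fun w ↦ w.1.2 := rfl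
  rw [this]
  exact (continuous_of_discreteTopology).comp (continuous_snd.comp continuous_subtype_val)

variable (F) in
theorem one_lt_residueCard : 1 < residueCard F := by
  have := finite_residueField (F := F)
  exact Finite.one_lt_card

theorem weilDegree_mul (w w' : WeilGroup F) :
    weilDegree (w * w') = weilDegree w + weilDegree w' := rfl

theorem weilDegree_inv (w : WeilGroup F) : weilDegree w⁻¹ = -weilDegree w := rfl

theorem weilDegree_zpow (w : WeilGroup F) (k : ℤ) : weilDegree (w ^ k) = k * weilDegree w := by
  simp [weilDegree]

theorem norm_omega (β : ℝ) (w : WeilGroup F) :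
    ‖((omega (β : ℂ) w : ℂˣ) : ℂ)‖ = weilNorm w ^ β := by
  change ‖((weilNorm w : ℂ) ^ (β : ℂ))‖ = _
  rw [Complex.norm_cpow_eq_rpow_re_of_pos (weilNorm_pos w), Complex.ofReal_re]

theorem omega_add (s t : ℂ) (w : WeilGroup F) : omega (s + t) w = omega s w * omega t w := by
  ext
  change (weilNorm w : ℂ) ^ (s + t) = (weilNorm w : ℂ) ^ s * (weilNorm w : ℂ) ^ t
  rw [Complex.cpow_add _ _ (by simpa using (weilNorm_pos w).ne')]

theorem omega_zero (w : WeilGroup F) : omega 0 w = 1 := by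
  ext
  change (weilNorm w : ℂ) ^ (0 : ℂ) = 1
  simp

theorem continuous_omega (s : ℂ) : Continuous fun w : WeilGroup F ↦ ((omega s w : ℂˣ) : ℂ) := by
  change Continuous fun w : WeilGroup F ↦ (weilNorm w : ℂ) ^ s
  refine Continuous.cpow (Complex.continuous_ofReal.comp continuous_weilNorm) continuous_const
    fun w ↦ Or.inl ?_
  simpa using weilNorm_pos w

end Weil

/-! ### Block diagonal matrices, standard Levi subgroups and their centralizing idempotents -/

section Blocks

variable {r n : ℕ} (k : Fin r → ℕ) (h : ∑ i, k i = n)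

/-- The numbering of the rows of a block matrix with consecutive blocks. -/
def blockEquiv : (Σ i, Fin (k i)) ≃ Fin n := finSigmaFinEquiv.trans (finCongr h)

/-- The block to which a row belongs. -/
def blockIndex (a : Fin n) : Fin r := ((blockEquiv k h).symm a).1

@[simp]
theorem blockIndex_blockEquiv (p : Σ i, Fin (k i)) : blockIndex k h (blockEquiv k h p) = p.1 := by
  simp [blockIndex]

theorem blockDiag_val (x : ∀ i, GL (Fin (k i)) ℂ) :
    (blockDiag k h x).val = Matrix.reindex (blockEquiv k h) (blockEquiv k h)
      (Matrix.blockDiagonal' fun i ↦ (x i).val) := rfl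

theorem blockDiag_apply_same (x : ∀ i, GL (Fin (k i)) ℂ) (i : Fin r) (a b : Fin (k i)) :
    (blockDiag k h x).val (blockEquiv k h ⟨i, a⟩) (blockEquiv k h ⟨i, b⟩) = (x i).val a b := by
  simp [blockDiag_val]

theorem blockDiag_apply_ne (x : ∀ i, GL (Fin (k i)) ℂ) {a b : Fin n}
    (hab : blockIndex k h a ≠ blockIndex k h b) : (blockDiag k h x).val a b = 0 := by
  simp only [blockDiag_val, Matrix.reindex_apply, Matrix.submatrix_apply]
  exact Matrix.blockDiagonal'_apply_ne _ _ _ hab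

theorem blockDiag_injective : Function.Injective (blockDiag k h) := by
  intro x y hxy
  funext i
  ext a b
  rw [← blockDiag_apply_same k h x, hxy, blockDiag_apply_same]

/-- The projection to the `i`-th diagonal block. -/
def blockProj (i : Fin r) : Matrix (Fin n) (Fin n) ℂ :=
  Matrix.diagonal fun a ↦ if blockIndex k h a = i then 1 else 0

theorem blockProj_mul_self (i : Fin r) : blockProj k h i * blockProj k h i = blockProj k h i := by
  simp [blockProj, Matrix.diagonal_mul_diagonal]

theorem sum_eq_sum_blocks {M : Type*} [AddCommMonoid M] (f : Fin n → M) :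
    ∑ a, f a = ∑ i, ∑ x : Fin (k i), f (blockEquiv k h ⟨i, x⟩) := by
  rw [← (blockEquiv k h).sum_comp, Fintype.sum_sigma]

theorem trace_blockProj (i : Fin r) : (blockProj k h i).trace = k i := by
  rw [blockProj, Matrix.trace_diagonal, sum_eq_sum_blocks k h]
  simp

/-- Commutation is the convenient form of block-diagonality: it passes to inverses and conjugates,
and it supplies idempotents whose traces are the block sizes. -/
theorem commute_blockProj_iff {M : Matrix (Fin n) (Fin n) ℂ} :
    (∀ i, Commute M (blockProj k h i)) ↔
      ∀ a b, blockIndex k h a ≠ blockIndex k h b → M a b = 0 := by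
  constructor
  · intro hM a b hab
    have := congrFun (congrFun (hM (blockIndex k h b)).eq a) b
    simpa [blockProj, Matrix.mul_diagonal, Matrix.diagonal_mul, hab] using this
  · intro hM i
    ext a b
    simp only [blockProj, Matrix.mul_diagonal, Matrix.diagonal_mul]
    by_cases hab : blockIndex k h a = blockIndex k h b
    · rw [hab, mul_comm]
    · rw [hM a b hab, zero_mul, mul_zero]

theorem mem_standardLevi_iff {x : GL (Fin n) ℂ} :
    x ∈ standardLevi k h ↔ ∀ a b, blockIndex k h a ≠ blockIndex k h b → x.val a b = 0 := by
  constructor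
  · rintro ⟨y, rfl⟩ a b hab
    exact blockDiag_apply_ne k h y hab
  · intro hx
    -- The inverse also commutes with the block projections, so its diagonal blocks invert those of
    -- `x`.
    have hx' : ∀ a b, blockIndex k h a ≠ blockIndex k h b → (x⁻¹).val a b = 0 :=
      (commute_blockProj_iff k h).1 fun i ↦
        (((commute_blockProj_iff k h).2 hx i).units_inv_left)
    have key : ∀ y z : Matrix (Fin n) (Fin n) ℂ,
        (∀ a b, blockIndex k h a ≠ blockIndex k h b → y a b = 0) → y * z = 1 → ∀ i,
        (Matrix.of fun a b : Fin (k i) ↦ y (blockEquiv k h ⟨i, a⟩) (blockEquiv k h ⟨i, b⟩)) *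
        (Matrix.of fun a b : Fin (k i) ↦ z (blockEquiv k h ⟨i, a⟩) (blockEquiv k h ⟨i, b⟩)) =
          1 := by
      intro y z hy hyz i
      ext a b
      have h1 := congrFun (congrFun hyz (blockEquiv k h ⟨i, a⟩)) (blockEquiv k h ⟨i, b⟩)
      rw [Matrix.mul_apply, sum_eq_sum_blocks k h, Finset.sum_eq_single i] at h1
      · simpa [Matrix.mul_apply, Matrix.one_apply] using h1
      · intro j _ hj
        refine Finset.sum_eq_zero fun c _ ↦ ?_
        rw [hy _ _ (by simpa using hj.symm), zero_mul]
      · simp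
    refine ⟨fun i ↦ ⟨_, _, key x.val (x⁻¹).val hx (by simp) i,
      key (x⁻¹).val x.val hx' (by simp) i⟩, ?_⟩
    ext a b
    by_cases hab : blockIndex k h a = blockIndex k h b
    · obtain ⟨⟨i, a⟩, rfl⟩ := (blockEquiv k h).surjective a
      obtain ⟨⟨j, b⟩, rfl⟩ := (blockEquiv k h).surjective b
      simp only [blockIndex_blockEquiv] at hab
      subst hab
      rw [blockDiag_apply_same]
      rfl
    · rw [blockDiag_apply_ne k h _ hab, hx a b hab]

theorem mem_standardLevi_iff_commute {x : GL (Fin n) ℂ} :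
    x ∈ standardLevi k h ↔ ∀ i, Commute x.val (blockProj k h i) := by
  rw [mem_standardLevi_iff, commute_blockProj_iff]

theorem mem_conjSubgroup {g x : GL (Fin n) ℂ} {H : Subgroup (GL (Fin n) ℂ)} :
    x ∈ conjSubgroup g H ↔ g⁻¹ * x * g ∈ H := by
  simp only [conjSubgroup, Subgroup.mem_map, MulEquiv.coe_toMonoidHom, MulAut.conj_apply]
  constructor
  · rintro ⟨y, hy, rfl⟩
    simpa [mul_assoc] using hy
  · intro hx
    exact ⟨_, hx, by group⟩

theorem commute_conj_iff {R : Type*} [Monoid R] (g : Rˣ) (x y : R) :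
    Commute x (g * y * ↑g⁻¹) ↔ Commute (↑g⁻¹ * x * g) y := by
  constructor
  · intro hc
    have := congrArg (fun z ↦ ↑g⁻¹ * z * (g : R)) hc.eq
    simpa [Commute, SemiconjBy, mul_assoc] using this
  · intro hc
    have := congrArg (fun z ↦ (g : R) * z * ↑g⁻¹) hc.eq
    simpa [Commute, SemiconjBy, mul_assoc] using this

theorem trace_conj (g : GL (Fin n) ℂ) (M : Matrix (Fin n) (Fin n) ℂ) :
    (g.val * M * (g⁻¹).val).trace = M.trace := by
  rw [Matrix.trace_mul_comm, ← mul_assoc, Units.inv_mul, one_mul]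

theorem conj_idempotent {R : Type*} [Monoid R] (g : Rˣ) {e : R} (he : e * e = e) :
    (g * e * ↑g⁻¹ : R) * (g * e * ↑g⁻¹) = g * e * ↑g⁻¹ := by
  have : (g * e * ↑g⁻¹ : R) * (g * e * ↑g⁻¹) = g * (e * e) * ↑g⁻¹ := by simp [mul_assoc]
  rw [this, he]

/-- An idempotent matrix that commutes with a standard Levi subgroup is a sum of some of the block
projections; in particular its trace is a sum of block sizes. -/
theorem exists_trace_eq_of_commute_standardLevi {e : Matrix (Fin n) (Fin n) ℂ} (he : e * e = e)
    (hc : ∀ x ∈ standardLevi k h, Commute e x.val) :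
    ∃ s : Finset (Fin r), e.trace = ∑ i ∈ s, (k i : ℂ) := by
  classical
  -- Distinct diagonal entries force a commuting matrix to be diagonal; the shift by one keeps the
  -- entries nonzero.
  let D : GL (Fin n) ℂ := Matrix.GeneralLinearGroup.mkOfDetNeZero
    (Matrix.diagonal fun a : Fin n ↦ ((a : ℕ) + 1 : ℂ)) (by
      rw [Matrix.det_diagonal, Finset.prod_ne_zero_iff]
      exact fun a _ ↦ Nat.cast_add_one_ne_zero _)
  have hD : D ∈ standardLevi k h := by
    rw [mem_standardLevi_iff]
    intro a b hab
    exact Matrix.diagonal_apply_ne _ (by rintro rfl; exact hab rfl)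
  have hdiag : ∀ a b, a ≠ b → e a b = 0 := by
    intro a b hab
    have h1 := congrFun (congrFun (hc D hD).eq a) b
    have hDv : D.val = Matrix.diagonal fun a : Fin n ↦ ((a : ℕ) + 1 : ℂ) := rfl
    rw [hDv, Matrix.mul_diagonal, Matrix.diagonal_mul] at h1
    have h2 : (((b : ℕ) : ℂ) - ((a : ℕ) : ℂ)) * e a b = 0 := by linear_combination h1
    refine (mul_eq_zero.1 h2).resolve_left fun h3 ↦ hab ?_
    rw [sub_eq_zero, Nat.cast_inj] at h3
    exact Fin.ext h3.symm
  have h01 : ∀ a, e a a = 0 ∨ e a a = 1 := by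
    intro a
    have h1 := congrFun (congrFun he a) a
    rw [Matrix.mul_apply, Finset.sum_eq_single a (fun b _ hb ↦ by rw [hdiag b a hb, mul_zero])
      (by simp)] at h1
    have h2 : e a a * (e a a - 1) = 0 := by linear_combination h1
    rcases mul_eq_zero.1 h2 with h3 | h3
    · exact Or.inl h3
    · exact Or.inr (sub_eq_zero.1 h3)
  have hconst : ∀ a b, blockIndex k h a = blockIndex k h b → e a a = e b b := by
    intro a b hab
    by_cases hne : a = b
    · rw [hne]
    -- For `a` and `b` in the same block this transvection lies in the Levi subgroup, and commuting
    -- with it equates two diagonal entries.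
    let U : GL (Fin n) ℂ := Matrix.GeneralLinearGroup.mkOfDetNeZero
      (Matrix.transvection a b (1 : ℂ)) (by simp [Matrix.det_transvection_of_ne _ _ hne])
    have hUv : U.val = 1 + Matrix.single a b (1 : ℂ) := rfl
    have hU : U ∈ standardLevi k h := by
      rw [mem_standardLevi_iff]
      intro c d hcd
      rw [hUv, Matrix.add_apply, Matrix.one_apply_ne (by rintro rfl; exact hcd rfl), zero_add,
        Matrix.single_apply, if_neg]
      rintro ⟨rfl, rfl⟩
      exact hcd hab
    have h1 := (hc U hU).eq
    rw [hUv, mul_add, add_mul, mul_one, one_mul, add_right_inj] at h1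
    simpa using congrFun (congrFun h1 a) b
  refine ⟨Finset.univ.filter fun i ↦ ∃ a, blockIndex k h a = i ∧ e a a = 1, ?_⟩
  rw [Matrix.trace, sum_eq_sum_blocks k h, Finset.sum_filter]
  refine Finset.sum_congr rfl fun i _ ↦ ?_
  split_ifs with hi
  · obtain ⟨a, ha, ha1⟩ := hi
    rw [Finset.sum_congr rfl (g := fun _ ↦ (1 : ℂ))]
    · simp
    · intro x _
      rw [Matrix.diag_apply, hconst _ a (by simp [ha]), ha1]
  · refine Finset.sum_eq_zero fun x _ ↦ ?_
    refine (h01 _).resolve_right fun hx ↦ hi ⟨_, ?_, hx⟩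
    simp

/-- A decomposition of `ℂ ^ n` becomes the standard one after a change of basis. -/
theorem exists_adapted_basis {V : Fin r → Submodule ℂ (Fin n → ℂ)} (hV : DirectSum.IsInternal V)
    (hk : ∀ i, Module.finrank ℂ (V i) = k i) :
    ∃ (h : ∑ i, k i = n) (x : GL (Fin n) ℂ), ∀ i v,
      x.val.mulVec v ∈ V i ↔ ∀ a, blockIndex k h a ≠ i → v a = 0 := by
  let b : ∀ i, Module.Basis (Fin (k i)) ℂ (V i) := fun i ↦ Module.finBasisOfFinrankEq ℂ (V i) (hk i)
  let B := hV.collectedBasis b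
  have h : ∑ i, k i = n := by
    have := Module.finrank_eq_card_basis B
    simpa using this.symm
  let C := B.reindex (blockEquiv k h)
  let x : GL (Fin n) ℂ :=
    ⟨LinearMap.toMatrix' C.equivFun.symm, LinearMap.toMatrix' C.equivFun,
      by rw [← LinearMap.toMatrix'_comp]; simp, by rw [← LinearMap.toMatrix'_comp]; simp⟩
  have hx : ∀ v, x.val.mulVec v = C.equivFun.symm v := fun v ↦ by
    change (LinearMap.toMatrix' C.equivFun.symm.toLinearMap).mulVec v = _
    rw [LinearMap.toMatrix'_mulVec]
    rfl
  have hC : ∀ a, C a ∈ V (blockIndex k h a) := fun a ↦ by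
    rw [Module.Basis.reindex_apply]
    exact hV.collectedBasis_mem b _
  refine ⟨h, x, fun i v ↦ ?_⟩
  rw [hx]
  constructor
  · intro hv a ha
    have h1 := hV.collectedBasis_repr_of_mem_ne b (i := i) (j := blockIndex k h a)
      (a := ((blockEquiv k h).symm a).2) (Ne.symm ha) hv
    have h2 : C.equivFun (C.equivFun.symm v) a = 0 := by
      rw [Module.Basis.equivFun_apply, Module.Basis.repr_reindex_apply]
      exact h1
    rwa [LinearEquiv.apply_symm_apply] at h2
  · intro hv
    rw [Module.Basis.equivFun_symm_apply]
    refine Submodule.sum_mem _ fun a _ ↦ ?_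
    by_cases ha : blockIndex k h a = i
    · exact Submodule.smul_mem _ _ (ha ▸ hC a)
    · rw [hv a ha, zero_smul]
      exact zero_mem _

/-- The matrix `x` carries the coordinate subspaces to the `V i`, so invariance under `y` becomes
block-diagonality in the new basis. -/
theorem conj_mem_standardLevi_of_invariant {V : Fin r → Submodule ℂ (Fin n → ℂ)}
    {x y : GL (Fin n) ℂ}
    (hx : ∀ i v, x.val.mulVec v ∈ V i ↔ ∀ a, blockIndex k h a ≠ i → v a = 0)
    (hy : ∀ i, ∀ v ∈ V i, y.val.mulVec v ∈ V i) : x⁻¹ * y * x ∈ standardLevi k h := by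
  rw [mem_standardLevi_iff]
  intro a b hab
  have h1 : x.val.mulVec (Pi.single b 1) ∈ V (blockIndex k h b) := by
    rw [hx]
    intro c hc
    exact Pi.single_eq_of_ne (by rintro rfl; exact hc rfl) _
  have h2 := hy _ _ h1
  have h3 : y.val.mulVec (x.val.mulVec (Pi.single b 1)) =
      x.val.mulVec ((x⁻¹ * y * x).val.mulVec (Pi.single b 1)) := by
    simp only [Matrix.mulVec_mulVec, Units.val_mul]
    simp [← mul_assoc]
  rw [h3, hx] at h2
  simpa using h2 a hab

end Blocks

/-! ### Relevance of Levi subgroups in terms of traces of idempotents -/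

section Relevance

variable (F : Type*) [NontriviallyNormedField F] [IsUltrametricDist F] [LocallyCompactSpace F]
variable (D : Type*) [DivisionRing D] [Algebra F D]

variable {F D} in
-- Conjugation to a standard Levi subgroup preserves traces, and there the trace is a sum of block
-- sizes, all multiples of `d`.
theorem IsRelevantLevi.exists_trace_eq {m : ℕ} {L : Subgroup (GL (Fin (m * index F D)) ℂ)}
    (hL : IsRelevantLevi F D m L) {e : Matrix (Fin (m * index F D)) (Fin (m * index F D)) ℂ}
    (he : e * e = e) (hc : ∀ x ∈ L, Commute e x.val) :
    ∃ t : ℕ, e.trace = ((t * index F D : ℕ) : ℂ) := by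
  obtain ⟨r, c, hc1, h, g, rfl⟩ := hL
  obtain ⟨s, hs⟩ := exists_trace_eq_of_commute_standardLevi _ (sum_mul_eq h _)
    (conj_idempotent g⁻¹ he) (fun x hx ↦ by
      have h1 := hc (g * x * g⁻¹) (by rw [mem_conjSubgroup]; simpa [mul_assoc] using hx)
      rw [Units.val_mul, Units.val_mul, commute_conj_iff] at h1
      simpa using h1)
  rw [trace_conj] at hs
  exact ⟨∑ i ∈ s, c i, by rw [hs, Finset.sum_mul]; push_cast; rfl⟩

/-- The conjugated block projections centralize the subgroup and have trace `k i`. Testing traces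
avoids matching the blocks of two conjugate Levi subgroups, which may be permuted. -/
theorem isRelevantLevi_conj_standardLevi_iff {m r : ℕ} {k : Fin r → ℕ} (hk : ∀ i, 1 ≤ k i)
    (h : ∑ i, k i = m * index F D) (hd : 0 < index F D) (g : GL (Fin (m * index F D)) ℂ) :
    IsRelevantLevi F D m (conjSubgroup g (standardLevi k h)) ↔ ∀ i, index F D ∣ k i := by
  constructor
  · intro hL i
    obtain ⟨t, ht⟩ := hL.exists_trace_eq (conj_idempotent g (blockProj_mul_self k h i))
      fun x hx ↦ by
        rw [mem_conjSubgroup, mem_standardLevi_iff_commute] at hx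
        exact ((commute_conj_iff g _ _).2 (hx i)).symm
    rw [trace_conj, trace_blockProj, Nat.cast_inj] at ht
    exact ⟨t, by rw [ht, mul_comm]⟩
  · intro hdvd
    choose c hc using hdvd
    have hkc : k = fun i ↦ c i * index F D := by
      funext i
      rw [hc i, mul_comm]
    subst hkc
    refine ⟨r, c, fun i ↦ Nat.pos_of_ne_zero fun h0 ↦ ?_, ?_, g, rfl⟩
    · have := hk i
      simp [h0] at this
    · rw [← Finset.sum_mul] at h
      exact Nat.eq_of_mul_eq_mul_right hd h

theorem conjSubgroup_one {n : ℕ} (H : Subgroup (GL (Fin n) ℂ)) : conjSubgroup 1 H = H := by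
  ext x
  simp [mem_conjSubgroup]

theorem trace_eq_finrank_range {n : ℕ} {e : Matrix (Fin n) (Fin n) ℂ} (he : e * e = e) :
    e.trace = Module.finrank ℂ (LinearMap.range (Matrix.toLin' e)) := by
  have hi : IsIdempotentElem (Matrix.toLin' e) := by
    rw [IsIdempotentElem, Module.End.mul_eq_comp, ← Matrix.toLin'_mul, he]
  rw [← Matrix.trace_toLin'_eq]
  exact LinearMap.IsProj.trace (LinearMap.isProj_range_iff_isIdempotentElem _ |>.2 hi)

/-- All Levi subgroups that contain the image of `φ` are relevant if and only if the ranks of all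
idempotents that commute with `φ` are multiples of `d`. -/
theorem forall_isRelevantLevi_iff {G : Type*} [Group G] {m : ℕ} (hd : 0 < index F D)
    (φ : G →* GL (Fin (m * index F D)) ℂ) :
    (∀ L, IsLevi L → φ.range ≤ L → IsRelevantLevi F D m L) ↔
      ∀ e : Matrix (Fin (m * index F D)) (Fin (m * index F D)) ℂ, e * e = e →
        (∀ g, Commute e (φ g).val) → ∃ t : ℕ, e.trace = ((t * index F D : ℕ) : ℂ) := by
  constructor
  · intro hφ e he hc
    let f := Matrix.toLin' e
    have hi : IsIdempotentElem f := by
      rw [IsIdempotentElem, Module.End.mul_eq_comp, ← Matrix.toLin'_mul, he]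
    have hcompl : IsCompl (LinearMap.range f) (LinearMap.ker f) :=
      LinearMap.IsIdempotentElem.isCompl hi
    -- Range and kernel of `e` are invariant under `φ`, so its image lies in the Levi subgroup that
    -- stabilizes both.
    let V : Fin 2 → Submodule ℂ (Fin (m * index F D) → ℂ) :=
      ![LinearMap.range f, LinearMap.ker f]
    have hV : DirectSum.IsInternal V :=
      (DirectSum.isInternal_submodule_iff_isCompl V (i := 0) (j := 1) (by simp) (by
        ext i; fin_cases i <;> simp)).2 hcompl
    obtain ⟨h, x, hx⟩ := exists_adapted_basis (fun i ↦ Module.finrank ℂ (V i)) hV fun _ ↦ rfl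
    have hrank : e.trace = ((Module.finrank ℂ (V 0) : ℕ) : ℂ) := trace_eq_finrank_range he
    rw [hrank]
    have hsum : Module.finrank ℂ (V 0) + Module.finrank ℂ (V 1) = m * index F D := by
      simpa using h
    -- Levi subgroups have nonempty blocks, so the idempotents `0` and `1` are treated apart.
    rcases Nat.eq_zero_or_pos (Module.finrank ℂ (V 0)) with h0 | h0
    · exact ⟨0, by simp [h0]⟩
    rcases Nat.eq_zero_or_pos (Module.finrank ℂ (V 1)) with h1 | h1
    · exact ⟨m, by rw [Nat.cast_inj]; omega⟩
    have hpos : ∀ i, 1 ≤ Module.finrank ℂ (V i) := by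
      intro i
      fin_cases i
      exacts [h0, h1]
    have hrel := hφ (conjSubgroup x (standardLevi _ h)) ⟨2, _, hpos, h, x, rfl⟩ (by
      rintro _ ⟨g, rfl⟩
      rw [mem_conjSubgroup]
      refine conj_mem_standardLevi_of_invariant _ h hx fun i v hv ↦ ?_
      have hcv : ∀ w, (φ g).val.mulVec (f w) = f ((φ g).val.mulVec w) := fun w ↦ by
        simp only [f, Matrix.toLin'_apply, Matrix.mulVec_mulVec]
        rw [(hc g).eq]
      fin_cases i
      · obtain ⟨w, rfl⟩ := hv
        exact ⟨_, (hcv w).symm⟩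
      · have hv' : f v = 0 := hv
        change f ((φ g).val.mulVec v) = 0
        rw [← hcv, hv', Matrix.mulVec_zero])
    rw [isRelevantLevi_conj_standardLevi_iff F D hpos h hd] at hrel
    obtain ⟨t, ht⟩ := hrel 0
    exact ⟨t, by rw [ht, mul_comm]⟩
  · rintro hφ _ ⟨r, k, hk, h, g, rfl⟩ hle
    rw [isRelevantLevi_conj_standardLevi_iff F D hk h hd]
    intro i
    obtain ⟨t, ht⟩ := hφ _ (conj_idempotent g (blockProj_mul_self k h i)) fun y ↦ by
        have hx := hle ⟨y, rfl⟩
        rw [mem_conjSubgroup, mem_standardLevi_iff_commute] at hx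
        exact ((commute_conj_iff g _ _).2 (hx i)).symm
    rw [trace_conj, trace_blockProj, Nat.cast_inj] at ht
    exact ⟨t, by rw [ht, mul_comm]⟩

theorem index_pos [FiniteDimensional F D] : 0 < index F D :=
  Nat.sqrt_pos.2 Module.finrank_pos

theorem isRelevantLevi_standardLevi_iff [FiniteDimensional F D] {m r : ℕ} {k : Fin r → ℕ}
    (hk : ∀ i, 1 ≤ k i) (h : ∑ i, k i = m * index F D) :
    IsRelevantLevi F D m (standardLevi k h) ↔ ∀ i, index F D ∣ k i := by
  rw [← isRelevantLevi_conj_standardLevi_iff F D hk h (index_pos F D) 1, conjSubgroup_one]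

end Relevance

/-! ### Bounded groups of matrices -/

section Bounded

variable {n : ℕ}

theorem norm_mulVec_le {M : Matrix (Fin n) (Fin n) ℂ} {C : ℝ} (hC : ∀ a b, ‖M a b‖ ≤ C)
    (v : Fin n → ℂ) : ‖M.mulVec v‖ ≤ n * C * ‖v‖ := by
  rcases Nat.eq_zero_or_pos n with rfl | hn
  · simp [Subsingleton.elim (M.mulVec v) 0]
  have hC0 : 0 ≤ C := (norm_nonneg _).trans (hC ⟨0, hn⟩ ⟨0, hn⟩)
  rw [pi_norm_le_iff_of_nonneg (by positivity)]
  intro a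
  calc ‖M.mulVec v a‖ ≤ ∑ b, ‖M a b * v b‖ := by
        change ‖∑ b, M a b * v b‖ ≤ _
        exact norm_sum_le _ _
    _ ≤ ∑ _b : Fin n, C * ‖v‖ := by
        refine Finset.sum_le_sum fun b _ ↦ ?_
        rw [norm_mul]
        exact mul_le_mul (hC a b) (norm_le_pi_norm v b) (norm_nonneg _) hC0
    _ = n * C * ‖v‖ := by simp [mul_assoc]

theorem exists_bound_mulVec_matrix (M : Matrix (Fin n) (Fin n) ℂ) :
    ∃ C, 0 ≤ C ∧ ∀ v : Fin n → ℂ, ‖M.mulVec v‖ ≤ C * ‖v‖ := by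
  refine ⟨n * ∑ a, ∑ b, ‖M a b‖, by positivity, norm_mulVec_le fun a b ↦ ?_⟩
  exact (Finset.single_le_sum (f := fun b ↦ ‖M a b‖) (fun _ _ ↦ norm_nonneg _)
    (Finset.mem_univ b)).trans (Finset.single_le_sum (f := fun a ↦ ∑ b, ‖M a b‖)
      (fun _ _ ↦ Finset.sum_nonneg fun _ _ ↦ norm_nonneg _) (Finset.mem_univ a))

theorem exists_bound_mulVec_of_isCompact {S : Set (GL (Fin n) ℂ)} (hS : IsCompact S) :
    ∃ C, ∀ g ∈ S, ∀ v : Fin n → ℂ, ‖g.val.mulVec v‖ ≤ C * ‖v‖ := by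
  have hcont : Continuous fun (g : GL (Fin n) ℂ) (a b : Fin n) ↦ g.val a b :=
    Units.continuous_val (M := Matrix (Fin n) (Fin n) ℂ)
  obtain ⟨C, hC⟩ := hS.exists_bound_of_continuousOn hcont.continuousOn
  exact ⟨n * C, fun g hg ↦ norm_mulVec_le fun a b ↦
    ((norm_le_pi_norm (g.val a) b).trans (norm_le_pi_norm (fun a b ↦ g.val a b) a)).trans
      (hC g hg)⟩

theorem norm_entry_le {M : Matrix (Fin n) (Fin n) ℂ} {C : ℝ}
    (hC : ∀ v : Fin n → ℂ, ‖M.mulVec v‖ ≤ C * ‖v‖) (a b : Fin n) : ‖M a b‖ ≤ C := by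
  have h1 := (norm_le_pi_norm _ a).trans (hC (Pi.single b 1))
  rwa [Pi.norm_single, norm_one, mul_one, Matrix.mulVec_single_one] at h1

/-- Compactness in `GL_n` also requires control of inverses. Here they are values of `f` again, so
the closed embedding `g ↦ (g, g⁻¹)` sends the image into a compact set. -/
theorem isCompact_closure_range_iff {W : Type*} [Group W] (f : W →* GL (Fin n) ℂ) :
    IsCompact (closure (Set.range f)) ↔
      ∃ C, ∀ w, ∀ v : Fin n → ℂ, ‖(f w).val.mulVec v‖ ≤ C * ‖v‖ := by
  constructor
  · intro h
    obtain ⟨C, hC⟩ := exists_bound_mulVec_of_isCompact h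
    exact ⟨C, fun w ↦ hC _ (subset_closure ⟨w, rfl⟩)⟩
  · rintro ⟨C, hC⟩
    let S : Set (Matrix (Fin n) (Fin n) ℂ) :=
      Set.univ.pi fun _ ↦ Set.univ.pi fun _ ↦ Metric.closedBall 0 C
    have hS : IsCompact S :=
      isCompact_univ_pi fun _ ↦ isCompact_univ_pi fun _ ↦ isCompact_closedBall _ _
    have hK := (Units.isClosedEmbedding_embedProduct (α := Matrix (Fin n) (Fin n) ℂ)
      ).isCompact_preimage (hS.prod (hS.image MulOpposite.continuous_op))
    refine hK.of_isClosed_subset isClosed_closure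
      (closure_minimal ?_ ?_)
    · rintro _ ⟨w, rfl⟩
      have hmem : ∀ w, (f w).val ∈ S := fun w a _ b _ ↦ by
        rw [mem_closedBall_zero_iff]
        exact norm_entry_le (hC w) a b
      exact ⟨hmem w, ⟨_, hmem w⁻¹, by rw [map_inv]; rfl⟩⟩
    · exact hK.isClosed

end Bounded

/-! ### Growth spaces and eigenspaces of Frobenius -/

section Growth

variable {F : Type*} [NontriviallyNormedField F] [IsUltrametricDist F] [LocallyCompactSpace F]
variable {n : ℕ} (φ : SL(2, ℂ) × WeilGroup F →* GL (Fin n) ℂ)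

/-- The vectors on which the Weil group acts with growth `‖w‖ ^ β`. -/
def growthSpace (β : ℝ) : Submodule ℂ (Fin n → ℂ) where
  carrier := {v | ∃ C : ℝ, ∀ w : WeilGroup F, ‖(φ (1, w)).val.mulVec v‖ ≤ C * weilNorm w ^ β}
  add_mem' := by
    rintro v v' ⟨C, hC⟩ ⟨C', hC'⟩
    refine ⟨C + C', fun w ↦ ?_⟩
    rw [Matrix.mulVec_add, add_mul]
    exact (norm_add_le _ _).trans (add_le_add (hC w) (hC' w))
  zero_mem' := ⟨0, fun w ↦ by simp⟩
  smul_mem' := by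
    rintro c v ⟨C, hC⟩
    refine ⟨‖c‖ * C, fun w ↦ ?_⟩
    rw [Matrix.mulVec_smul, norm_smul, mul_assoc]
    exact mul_le_mul_of_nonneg_left (hC w) (norm_nonneg _)

variable {φ}

theorem mem_growthSpace {β : ℝ} {v : Fin n → ℂ} : v ∈ growthSpace φ β ↔
    ∃ C : ℝ, ∀ w : WeilGroup F, ‖(φ (1, w)).val.mulVec v‖ ≤ C * weilNorm w ^ β := Iff.rfl

/-- Intertwining matrices preserve the growth. -/
theorem mulVec_mem_growthSpace {e : Matrix (Fin n) (Fin n) ℂ} (ψ : SL(2, ℂ) × WeilGroup F →* GL (Fin n) ℂ)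
    (he : ∀ w, e * (φ (1, w)).val = (ψ (1, w)).val * e) {β : ℝ} {v : Fin n → ℂ}
    (hv : v ∈ growthSpace φ β) : e.mulVec v ∈ growthSpace ψ β := by
  obtain ⟨C, hC⟩ := hv
  obtain ⟨K, hK0, hK⟩ := exists_bound_mulVec_matrix e
  refine ⟨K * C, fun w ↦ ?_⟩
  rw [Matrix.mulVec_mulVec, ← he, ← Matrix.mulVec_mulVec, mul_assoc]
  exact (hK _).trans (mul_le_mul_of_nonneg_left (hC w) hK0)

/-- Translating `w` by `w'` changes the constant by `‖w'‖ ^ β`, and `φ (A, 1)` commutes with the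
action of the Weil group. -/
theorem growthSpace_invariant {β : ℝ} (g : SL(2, ℂ) × WeilGroup F) {v : Fin n → ℂ}
    (hv : v ∈ growthSpace φ β) : (φ g).val.mulVec v ∈ growthSpace φ β := by
  obtain ⟨A, w'⟩ := g
  have h1 : (φ (1, w')).val.mulVec v ∈ growthSpace φ β := by
    obtain ⟨C, hC⟩ := hv
    refine ⟨C * weilNorm w' ^ β, fun w ↦ ?_⟩
    have h2 := hC (w * w')
    rw [weilNorm_mul, Real.mul_rpow (weilNorm_pos w).le (weilNorm_pos w').le] at h2
    rw [Matrix.mulVec_mulVec, ← Units.val_mul, ← map_mul, Prod.mk_mul_mk, one_mul]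
    linarith
  have h3 : (φ (A, w')).val = (φ (A, 1)).val * (φ (1, w')).val := by
    rw [← Units.val_mul, ← map_mul, Prod.mk_mul_mk, one_mul, mul_one]
  rw [h3, ← Matrix.mulVec_mulVec]
  refine mulVec_mem_growthSpace φ (fun w ↦ ?_) h1
  rw [← Units.val_mul, ← map_mul, ← Units.val_mul, ← map_mul, Prod.mk_mul_mk, Prod.mk_mul_mk]
  simp

variable {w₀ : WeilGroup F} (hw₀ : weilDegree w₀ = 1)

theorem mulVec_zpow_of_eigen {M : GL (Fin n) ℂ} {c : ℂ} (hc : c ≠ 0) {v : Fin n → ℂ}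
    (hv : M.val.mulVec v = c • v) (j : ℤ) : (M ^ j).val.mulVec v = c ^ j • v := by
  have hinv : (M⁻¹).val.mulVec v = c⁻¹ • v := by
    have h1 := congrArg (fun u ↦ c⁻¹ • (M⁻¹).val.mulVec u) hv
    simp only [Matrix.mulVec_mulVec, Matrix.mulVec_smul, smul_smul, inv_mul_cancel₀ hc] at h1
    simpa using h1.symm
  induction j with
  | zero => simp
  | succ i ih =>
    rw [zpow_add_one, Units.val_mul, ← Matrix.mulVec_mulVec, hv, Matrix.mulVec_smul, ih, smul_smul,
      zpow_add_one₀ hc, mul_comm]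
  | pred i ih =>
    rw [zpow_sub_one, Units.val_mul, ← Matrix.mulVec_mulVec, hinv, Matrix.mulVec_smul, ih,
      smul_smul, zpow_sub_one₀ hc, mul_comm]

theorem eigenvalue_ne_zero {M : GL (Fin n) ℂ} {c : ℂ} {v : Fin n → ℂ} (hv0 : v ≠ 0)
    (hv : M.val.mulVec v = c • v) : c ≠ 0 := by
  rintro rfl
  apply hv0
  have h1 := congrArg (fun u ↦ (M⁻¹).val.mulVec u) hv
  simpa [Matrix.mulVec_mulVec] using h1

theorem map_one_zpow (w : WeilGroup F) (j : ℤ) : φ (1, w ^ j) = φ (1, w) ^ j := by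
  rw [← map_zpow]
  congr 1
  ext <;> simp

/-- Bounded positive powers give `t ≤ 1`, bounded negative powers give `1 ≤ t`. -/
theorem eq_one_of_forall_zpow_le {t C : ℝ} (ht : 0 < t) (h : ∀ j : ℤ, t ^ j ≤ C) : t = 1 := by
  have key : ∀ s : ℝ, (∀ j : ℕ, s ^ j ≤ C) → s ≤ 1 := by
    intro s hs
    by_contra! hc
    obtain ⟨j, hj⟩ := pow_unbounded_of_one_lt C hc
    exact (hs j).not_gt hj
  refine le_antisymm (key t fun j ↦ by simpa using h j) ?_
  exact (inv_le_one₀ ht).1 (key t⁻¹ fun j ↦ by simpa using h (-j))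

include hw₀

theorem weilNorm_of_degree_one (β : ℝ) (j : ℤ) :
    weilNorm (w₀ ^ j) ^ β = ((residueCard F : ℝ) ^ β) ^ j := by
  rw [weilNorm, weilDegree_zpow, hw₀, mul_one, ← Real.rpow_intCast, ← Real.rpow_intCast,
    ← Real.rpow_mul (by positivity), ← Real.rpow_mul (by positivity), mul_comm]

theorem norm_eigenvalue_of_mem_growthSpace {β : ℝ} {c : ℂ} {v : Fin n → ℂ} (hv0 : v ≠ 0)
    (hv : (φ (1, w₀)).val.mulVec v = c • v) (hmem : v ∈ growthSpace φ β) :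
    ‖c‖ = (residueCard F : ℝ) ^ β := by
  obtain ⟨C, hC⟩ := hmem
  have hc := eigenvalue_ne_zero hv0 hv
  have hq : 0 < (residueCard F : ℝ) ^ β :=
    Real.rpow_pos_of_pos (by exact_mod_cast residueCard_pos) _
  have hv' : 0 < ‖v‖ := norm_pos_iff.2 hv0
  -- The growth bound at the elements `w₀ ^ j` bounds all integral powers of `‖c‖ / q ^ β`.
  refine (div_eq_one_iff_eq hq.ne').1 (eq_one_of_forall_zpow_le (C := C / ‖v‖)
    (div_pos (norm_pos_iff.2 hc) hq) fun j ↦ ?_)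
  have h1 := hC (w₀ ^ j)
  rw [map_one_zpow, mulVec_zpow_of_eigen hc hv, norm_smul, norm_zpow,
    weilNorm_of_degree_one hw₀] at h1
  rw [div_zpow, div_le_div_iff₀ (zpow_pos hq _) hv']
  exact h1

theorem mem_growthSpace_of_eigen (hφ : Continuous fun w : WeilGroup F ↦ φ (1, w)) {β : ℝ} {c : ℂ}
    {v : Fin n → ℂ} (hv : (φ (1, w₀)).val.mulVec v = c • v)
    (hc : ‖c‖ = (residueCard F : ℝ) ^ β) : v ∈ growthSpace φ β := by
  obtain ⟨C, hC⟩ := exists_bound_mulVec_of_isCompact ((isCompact_inertia F).image hφ)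
  have hc0 : c ≠ 0 := by
    rw [← norm_ne_zero_iff, hc]
    exact (Real.rpow_pos_of_pos (by exact_mod_cast residueCard_pos) _).ne'
  refine ⟨C * ‖v‖, fun w ↦ ?_⟩
  -- In `w = i * w₀ ^ d(w)` the power of `w₀` scales `v` by a number of absolute value exactly `‖w‖
  -- ^ β`, and the inertial factor `i` acts within a fixed bound by compactness.
  let i := w * (w₀ ^ weilDegree w)⁻¹
  have hi : weilDegree i = 0 := by
    simp only [i, weilDegree_mul, weilDegree_inv, weilDegree_zpow, hw₀]
    ring
  have hw : (φ (1, w)).val = (φ (1, i)).val * (φ (1, w₀) ^ weilDegree w).val := by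
    rw [← map_one_zpow, ← Units.val_mul, ← map_mul, Prod.mk_mul_mk, one_mul]
    simp [i]
  have hn : weilNorm w ^ β = ‖c ^ weilDegree w‖ := by
    rw [norm_zpow, hc, ← weilNorm_of_degree_one hw₀]
    simp [weilNorm, weilDegree_zpow, hw₀]
  rw [hw, ← Matrix.mulVec_mulVec, mulVec_zpow_of_eigen hc0 hv, Matrix.mulVec_smul, norm_smul, hn,
    mul_comm]
  exact mul_le_mul_of_nonneg_right (hC _ ⟨i, hi, rfl⟩ v) (norm_nonneg _)

omit hw₀ in
theorem iSup_eigenspace_eq_top {f : Module.End ℂ (Fin n → ℂ)} (hf : f.IsSemisimple) :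
    ⨆ c, f.eigenspace c = ⊤ := by
  rw [← Module.End.iSup_maxGenEigenspace_eq_top f]
  exact iSup_congr fun c ↦
    (hf.isFinitelySemisimple.maxGenEigenspace_eq_eigenspace c).symm

/-- A growth space is stable under the diagonalizable matrix `φ (1, w₀)`, hence is the sum of its
intersections with the eigenspaces, and the absolute value of the eigenvalue determines the growth
of an eigenvector. -/
theorem growthSpace_eq_iSup (hφ : Continuous fun w : WeilGroup F ↦ φ (1, w))
    (hs : Module.End.IsSemisimple (Matrix.toLin' (φ (1, w₀)).val)) (β : ℝ) :
    growthSpace φ β = ⨆ c ∈ {c : ℂ | ‖c‖ = (residueCard F : ℝ) ^ β},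
      Module.End.eigenspace (Matrix.toLin' (φ (1, w₀)).val) c := by
  apply le_antisymm
  · have h1 := Submodule.eq_iSup_inf_genEigenspace (p := growthSpace φ β)
      (f := Matrix.toLin' (φ (1, w₀)).val) 1
      (fun v hv ↦ by
        rw [Matrix.toLin'_apply]
        exact growthSpace_invariant _ hv) (iSup_eigenspace_eq_top hs)
    rw [h1]
    refine iSup_le fun c v hv ↦ ?_
    have hcv : (φ (1, w₀)).val.mulVec v = c • v := by
      rw [← Matrix.toLin'_apply]
      exact Module.End.mem_eigenspace_iff.1 hv.2
    by_cases hv0 : v = 0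
    · rw [hv0]; exact zero_mem _
    · exact Submodule.mem_iSup_of_mem c (Submodule.mem_iSup_of_mem
        (norm_eigenvalue_of_mem_growthSpace hw₀ hv0 hcv hv.1) hv.2)
  · refine iSup₂_le fun c hc v hv ↦ mem_growthSpace_of_eigen hw₀ hφ ?_ hc
    rw [← Matrix.toLin'_apply]
    exact Module.End.mem_eigenspace_iff.1 hv

omit hw₀

theorem iSupIndep_growthSpace (hφ : Continuous fun w : WeilGroup F ↦ φ (1, w))
    (hs : ∀ w : WeilGroup F, Module.End.IsSemisimple (Matrix.toLin' (φ (1, w)).val)) :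
    iSupIndep (growthSpace φ) := by
  obtain ⟨w₀, hw₀⟩ := exists_weilDegree_eq_one F
  intro β
  simp only [growthSpace_eq_iSup hw₀ hφ (hs w₀)]
  have hq : 1 < (residueCard F : ℝ) := by exact_mod_cast one_lt_residueCard F
  -- Since `q > 1`, distinct exponents give distinct `q ^ β`, so different growth spaces collect
  -- disjoint sets of eigenspaces.
  refine ((Module.End.eigenspaces_iSupIndep
    (Matrix.toLin' (φ (1, w₀)).val)).disjoint_biSup_biSup
      (s := {c : ℂ | ‖c‖ = (residueCard F : ℝ) ^ β})
      (t := {c : ℂ | ∃ β' ≠ β, ‖c‖ = (residueCard F : ℝ) ^ β'}) ?_).mono_right ?_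
  · rw [Set.disjoint_left]
    rintro c hc ⟨β', hne, hc'⟩
    exact hne (Real.rpow_right_inj (by linarith) hq.ne' |>.1 (hc'.symm.trans hc))
  · exact iSup₂_le fun β' hne ↦ iSup₂_le fun c hc ↦
      le_biSup (fun c ↦ Module.End.eigenspace (Matrix.toLin' (φ (1, w₀)).val) c) ⟨β', hne, hc⟩

theorem iSup_growthSpace (hφ : Continuous fun w : WeilGroup F ↦ φ (1, w))
    (hs : ∀ w : WeilGroup F, Module.End.IsSemisimple (Matrix.toLin' (φ (1, w)).val)) :
    ⨆ β, growthSpace φ β = ⊤ := by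
  obtain ⟨w₀, hw₀⟩ := exists_weilDegree_eq_one F
  rw [eq_top_iff, ← iSup_eigenspace_eq_top (hs w₀)]
  refine iSup_le fun c v hv ↦ ?_
  have hcv : (φ (1, w₀)).val.mulVec v = c • v := by
    rw [← Matrix.toLin'_apply]
    exact Module.End.mem_eigenspace_iff.1 hv
  by_cases hv0 : v = 0
  · rw [hv0]; exact zero_mem _
  have hc := eigenvalue_ne_zero hv0 hcv
  have hq : 1 < (residueCard F : ℝ) := by exact_mod_cast one_lt_residueCard F
  -- The exponent solves `q ^ β = ‖c‖`, which is possible because `c ≠ 0`.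
  refine Submodule.mem_iSup_of_mem (Real.logb (residueCard F) ‖c‖)
    (mem_growthSpace_of_eigen hw₀ hφ hcv ?_)
  rw [Real.rpow_logb (by linarith) hq.ne' (norm_pos_iff.2 hc)]

end Growth

/-! ### The algebra of block diagonal matrices -/

section BlockMatrix

variable {r n : ℕ} (k : Fin r → ℕ) (h : ∑ i, k i = n)

/-- Block diagonal matrices, as an algebra homomorphism. -/
def blockMatrix : (∀ i, Matrix (Fin (k i)) (Fin (k i)) ℂ) →ₐ[ℂ] Matrix (Fin n) (Fin n) ℂ where
  toRingHom := (Matrix.reindexRingEquiv ℂ (blockEquiv k h)).toRingHom.comp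
    (Matrix.blockDiagonal'RingHom (fun i ↦ Fin (k i)) ℂ)
  commutes' c := by
    ext a b
    obtain ⟨⟨i, a⟩, rfl⟩ := (blockEquiv k h).surjective a
    obtain ⟨⟨j, b⟩, rfl⟩ := (blockEquiv k h).surjective b
    by_cases hij : i = j
    · subst hij
      simp [Matrix.algebraMap_matrix_apply, Pi.algebraMap_apply]
    · simp [Matrix.algebraMap_matrix_apply, Matrix.blockDiagonal'_apply_ne, hij]

variable {k}

theorem blockMatrix_apply_same (M : ∀ i, Matrix (Fin (k i)) (Fin (k i)) ℂ) (i : Fin r)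
    (a b : Fin (k i)) :
    blockMatrix k h M (blockEquiv k h ⟨i, a⟩) (blockEquiv k h ⟨i, b⟩) = M i a b := by
  simp [blockMatrix]

theorem blockMatrix_apply_ne (M : ∀ i, Matrix (Fin (k i)) (Fin (k i)) ℂ) {a b : Fin n}
    (hab : blockIndex k h a ≠ blockIndex k h b) : blockMatrix k h M a b = 0 := by
  exact Matrix.blockDiagonal'_apply_ne M _ _ hab

theorem blockMatrix_injective : Function.Injective (blockMatrix k h) := by
  intro x y hxy
  funext i
  ext a b
  rw [← blockMatrix_apply_same h x, hxy, blockMatrix_apply_same]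

theorem trace_blockMatrix (M : ∀ i, Matrix (Fin (k i)) (Fin (k i)) ℂ) :
    (blockMatrix k h M).trace = ∑ i, (M i).trace := by
  rw [Matrix.trace, sum_eq_sum_blocks k h]
  refine Finset.sum_congr rfl fun i _ ↦ Finset.sum_congr rfl fun a _ ↦ ?_
  exact blockMatrix_apply_same h M i a a

theorem exists_eq_blockMatrix {M : Matrix (Fin n) (Fin n) ℂ}
    (hM : ∀ i, Commute M (blockProj k h i)) : ∃ N, M = blockMatrix k h N := by
  rw [commute_blockProj_iff] at hM
  refine ⟨fun i ↦ Matrix.of fun a b ↦ M (blockEquiv k h ⟨i, a⟩) (blockEquiv k h ⟨i, b⟩), ?_⟩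
  ext a b
  by_cases hab : blockIndex k h a = blockIndex k h b
  · obtain ⟨⟨i, a⟩, rfl⟩ := (blockEquiv k h).surjective a
    obtain ⟨⟨j, b⟩, rfl⟩ := (blockEquiv k h).surjective b
    simp only [blockIndex_blockEquiv] at hab
    subst hab
    rw [blockMatrix_apply_same]
    rfl
  · rw [blockMatrix_apply_ne h _ hab, hM a b hab]

theorem blockMatrix_mulVec (M : ∀ i, Matrix (Fin (k i)) (Fin (k i)) ℂ) (v : Fin n → ℂ)
    (i : Fin r) (a : Fin (k i)) :
    (blockMatrix k h M).mulVec v (blockEquiv k h ⟨i, a⟩) =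
      (M i).mulVec (fun b ↦ v (blockEquiv k h ⟨i, b⟩)) a := by
  simp only [Matrix.mulVec, dotProduct]
  rw [sum_eq_sum_blocks k h, Finset.sum_eq_single i]
  · simp [blockMatrix_apply_same]
  · intro j _ hj
    refine Finset.sum_eq_zero fun c _ ↦ ?_
    rw [blockMatrix_apply_ne h _ (by simpa using hj.symm), zero_mul]
  · simp

end BlockMatrix

/-! ### Semisimplicity under conjugation and block sums -/

section Semisimple

open Polynomial

/-- The polynomial criterion transports along algebra homomorphisms such as conjugation and block
sums. -/
theorem isSemisimple_toLin'_iff {n : ℕ} {M : Matrix (Fin n) (Fin n) ℂ} :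
    Module.End.IsSemisimple (Matrix.toLin' M) ↔ ∃ p : ℂ[X], Squarefree p ∧ aeval M p = 0 := by
  have key : ∀ p : ℂ[X], aeval (Matrix.toLin' M) p = Matrix.toLin' (aeval M p) := fun p ↦
    aeval_algHom_apply (Matrix.toLinAlgEquiv' (R := ℂ) (n := Fin n)) M p
  constructor
  · intro hM
    refine ⟨_, hM.minpoly_squarefree, Matrix.toLin'.injective ?_⟩
    rw [← key, minpoly.aeval, map_zero]
  · rintro ⟨p, hp, h0⟩
    exact Module.End.isSemisimple_of_squarefree_aeval_eq_zero hp (by rw [key, h0, map_zero])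

theorem isSemisimple_conj {n : ℕ} {M : Matrix (Fin n) (Fin n) ℂ} (x : GL (Fin n) ℂ)
    (hM : Module.End.IsSemisimple (Matrix.toLin' M)) :
    Module.End.IsSemisimple (Matrix.toLin' (x.val * M * (x⁻¹).val)) := by
  rw [isSemisimple_toLin'_iff] at *
  obtain ⟨p, hp, h0⟩ := hM
  refine ⟨p, hp, ?_⟩
  have := aeval_algHom_apply (MulSemiringAction.toAlgHom ℂ (Matrix (Fin n) (Fin n) ℂ)
    (ConjAct.toConjAct x)) M p
  rw [h0, map_zero] at this
  simpa [ConjAct.units_smul_def] using this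

theorem isSemisimple_blockMatrix_iff {r n : ℕ} {k : Fin r → ℕ} (h : ∑ i, k i = n)
    {M : ∀ i, Matrix (Fin (k i)) (Fin (k i)) ℂ} :
    Module.End.IsSemisimple (Matrix.toLin' (blockMatrix k h M)) ↔
      ∀ i, Module.End.IsSemisimple (Matrix.toLin' (M i)) := by
  have key : ∀ p : ℂ[X], aeval (blockMatrix k h M) p = 0 ↔ ∀ i, aeval (M i) p = 0 := by
    intro p
    rw [aeval_algHom_apply, map_eq_zero_iff _ (blockMatrix_injective h), funext_iff]
    refine forall_congr' fun i ↦ ?_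
    have := aeval_algHom_apply
      (Pi.evalAlgHom ℂ (fun i ↦ Matrix (Fin (k i)) (Fin (k i)) ℂ) i) M p
    rw [Pi.evalAlgHom_apply, Pi.evalAlgHom_apply] at this
    rw [← this]
    rfl
  simp only [isSemisimple_toLin'_iff, key]
  constructor
  · rintro ⟨p, hp, h0⟩ i
    exact ⟨p, hp, h0 i⟩
  · intro hM
    choose p hp h0 using hM
    have hprod : ∏ i, p i ≠ 0 := Finset.prod_ne_zero_iff.2 fun i _ ↦ (hp i).ne_zero
    -- The `p i` may share roots, so their product need not be squarefree; its radical is, and each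
    -- `p i` still divides it.
    refine ⟨UniqueFactorizationMonoid.radical (∏ i, p i),
      UniqueFactorizationMonoid.squarefree_radical, fun i ↦ ?_⟩
    have hdvd : p i ∣ UniqueFactorizationMonoid.radical (∏ i, p i) :=
      (UniqueFactorizationMonoid.dvd_radical_iff (hp i).isRadical hprod).2
        (Finset.dvd_prod_of_mem _ (Finset.mem_univ i))
    obtain ⟨s, hs⟩ := hdvd
    rw [hs, map_mul, h0 i, zero_mul]

end Semisimple

/-! ### Continuity of homomorphisms into unit groups -/

section Continuity

/-- The inverse of a value is the value at the inverse, so the topology of units imposes no further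
condition. -/
theorem continuous_units_monoidHom_iff {W R : Type*} [Group W] [TopologicalSpace W]
    [ContinuousInv W] [Monoid R] [TopologicalSpace R] {f : W →* Rˣ} :
    Continuous f ↔ Continuous fun w ↦ (f w : R) := by
  refine ⟨fun hf ↦ Units.continuous_val.comp hf, fun hf ↦ Units.continuous_iff.2 ⟨hf, ?_⟩⟩
  have : (fun w ↦ (↑(f w)⁻¹ : R)) = (fun w ↦ (f w : R)) ∘ fun w ↦ w⁻¹ := by
    funext w
    simp
  rw [this]
  exact hf.comp continuous_inv

end Continuity

/-! ### L-homomorphisms under conjugation, twisting and direct sums -/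

section LHom

variable {F : Type*} [NontriviallyNormedField F] [IsUltrametricDist F] [LocallyCompactSpace F]
variable {D : Type*} [DivisionRing D] [Algebra F D]

/-- The condition on the ranks of commuting idempotents that corresponds to relevance. -/
def IdempotentTracesDvd {G : Type*} [Group G] {n : ℕ} (d : ℕ) (φ : G →* GL (Fin n) ℂ) : Prop :=
  ∀ e : Matrix (Fin n) (Fin n) ℂ, e * e = e → (∀ g, Commute e (φ g).val) →
    ∃ t : ℕ, e.trace = ((t * d : ℕ) : ℂ)

/-- The conditions on an L-homomorphism other than relevance. -/
structure IsAdmissible {n : ℕ} (φ : SL(2, ℂ) × WeilGroup F →* GL (Fin n) ℂ) : Prop where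
  rational : ∀ i j, ∃ P : MvPolynomial (Fin 2 × Fin 2) ℂ, ∀ A : SL(2, ℂ),
    (φ (A, 1)).val i j = MvPolynomial.eval (fun p ↦ A.val p.1 p.2) P
  continuous : Continuous fun w : WeilGroup F ↦ (φ (1, w)).val
  semisimple : ∀ w : WeilGroup F, Module.End.IsSemisimple (Matrix.toLin' (φ (1, w)).val)

theorem continuous_weil_iff {n : ℕ} {φ : SL(2, ℂ) × WeilGroup F →* GL (Fin n) ℂ} :
    (Continuous fun w : WeilGroup F ↦ φ (1, w)) ↔
      Continuous fun w : WeilGroup F ↦ (φ (1, w)).val :=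
  continuous_units_monoidHom_iff (f := φ.comp (MonoidHom.inr SL(2, ℂ) (WeilGroup F)))

/-- The two conditions on the right make sense in every matrix size, so they can be applied to
summands before their sizes are known to be multiples of `d`. -/
theorem isLHom_iff (hd : 0 < index F D) {m : ℕ}
    {φ : SL(2, ℂ) × WeilGroup F →* GL (Fin (m * index F D)) ℂ} :
    IsLHom D m φ ↔ IsAdmissible φ ∧ IdempotentTracesDvd (index F D) φ := by
  constructor
  · rintro ⟨h1, h2, h3, h4⟩
    exact ⟨⟨h1, continuous_weil_iff.1 h2, h3⟩, (forall_isRelevantLevi_iff F D hd φ).1 h4⟩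
  · rintro ⟨⟨h1, h2, h3⟩, h4⟩
    exact ⟨h1, continuous_weil_iff.2 h2, h3, (forall_isRelevantLevi_iff F D hd φ).2 h4⟩

variable {n : ℕ}

/-- The conjugate homomorphism `x φ x⁻¹`. -/
def conjHom {G : Type*} [Group G] (x : GL (Fin n) ℂ) (φ : G →* GL (Fin n) ℂ) :
    G →* GL (Fin n) ℂ :=
  (MulAut.conj x).toMonoidHom.comp φ

theorem conjHom_apply {G : Type*} [Group G] (x : GL (Fin n) ℂ) (φ : G →* GL (Fin n) ℂ) (g : G) :
    conjHom x φ g = x * φ g * x⁻¹ := rfl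

theorem conjHom_val {G : Type*} [Group G] (x : GL (Fin n) ℂ) (φ : G →* GL (Fin n) ℂ) (g : G) :
    (conjHom x φ g).val = x.val * (φ g).val * (x⁻¹).val := rfl

theorem IsAdmissible.conjHom {φ : SL(2, ℂ) × WeilGroup F →* GL (Fin n) ℂ} (hφ : IsAdmissible φ)
    (x : GL (Fin n) ℂ) : IsAdmissible (conjHom x φ) where
  rational i j := by
    choose P hP using hφ.rational
    refine ⟨∑ b, (∑ a, MvPolynomial.C (x.val i a) * P a b) * MvPolynomial.C ((x⁻¹).val b j),
      fun A ↦ ?_⟩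
    rw [conjHom_val, Matrix.mul_apply, map_sum]
    refine Finset.sum_congr rfl fun b _ ↦ ?_
    rw [Matrix.mul_apply, map_mul, map_sum, MvPolynomial.eval_C]
    congr 1
    exact Finset.sum_congr rfl fun a _ ↦ by rw [map_mul, MvPolynomial.eval_C, hP]
  continuous := by
    simp only [conjHom_val]
    exact (continuous_const.mul hφ.continuous).mul continuous_const
  semisimple w := by
    rw [conjHom_val]
    exact isSemisimple_conj x (hφ.semisimple w)

theorem IdempotentTracesDvd.conjHom {G : Type*} [Group G] {d : ℕ} {φ : G →* GL (Fin n) ℂ}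
    (hφ : IdempotentTracesDvd d φ) (x : GL (Fin n) ℂ) :
    IdempotentTracesDvd d (conjHom x φ) := by
  intro e he hc
  obtain ⟨t, ht⟩ := hφ _ (conj_idempotent x⁻¹ he) fun g ↦ by
    have := (commute_conj_iff x _ _).1 (hc g)
    simpa using this
  exact ⟨t, by rw [← ht, trace_conj]⟩

theorem twist_val (φ : SL(2, ℂ) × WeilGroup F →* GL (Fin n) ℂ) (χ : WeilGroup F →* ℂˣ)
    (g : SL(2, ℂ) × WeilGroup F) : (twist φ χ g).val = ((χ g.2 : ℂˣ) : ℂ) • (φ g).val := by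
  ext a b
  simp [twist, Matrix.GeneralLinearGroup.scalar, Matrix.smul_apply]

theorem IsAdmissible.twist {φ : SL(2, ℂ) × WeilGroup F →* GL (Fin n) ℂ} (hφ : IsAdmissible φ)
    (s : ℂ) : IsAdmissible (twist φ (omega s)) where
  rational i j := by
    obtain ⟨P, hP⟩ := hφ.rational i j
    exact ⟨P, fun A ↦ by rw [← hP, twist_val]; simp⟩
  continuous := by
    simp only [twist_val]
    exact (continuous_omega s).smul hφ.continuous
  semisimple w := by
    rw [twist_val, map_smul]
    exact Module.End.IsSemisimple_smul _ (hφ.semisimple w)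

theorem IdempotentTracesDvd.twist {d : ℕ} {φ : SL(2, ℂ) × WeilGroup F →* GL (Fin n) ℂ}
    (hφ : IdempotentTracesDvd d φ) (χ : WeilGroup F →* ℂˣ) :
    IdempotentTracesDvd d (twist φ χ) := by
  intro e he hc
  refine hφ e he fun g ↦ ?_
  have h1 := hc g
  rw [twist_val] at h1
  have h2 := h1.smul_right (((χ g.2)⁻¹ : ℂˣ) : ℂ)
  rwa [smul_smul, Units.inv_mul, one_smul] at h2

variable {r : ℕ} {k : Fin r → ℕ} (h : ∑ i, k i = n)

/-- The direct sum of homomorphisms into general linear groups. -/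
def directSum {G : Type*} [Group G] (ψ : ∀ i, G →* GL (Fin (k i)) ℂ) : G →* GL (Fin n) ℂ :=
  (blockDiag k h).comp (MonoidHom.pi ψ)

theorem directSum_val {G : Type*} [Group G] (ψ : ∀ i, G →* GL (Fin (k i)) ℂ) (g : G) :
    (directSum h ψ g).val = blockMatrix k h fun i ↦ (ψ i g).val := rfl

theorem isAdmissible_directSum_iff {ψ : ∀ i, SL(2, ℂ) × WeilGroup F →* GL (Fin (k i)) ℂ} :
    IsAdmissible (directSum h ψ) ↔ ∀ i, IsAdmissible (ψ i) := by
  constructor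
  · intro hφ i
    refine ⟨fun a b ↦ ?_, ?_, fun w ↦ ?_⟩
    · obtain ⟨P, hP⟩ := hφ.rational (blockEquiv k h ⟨i, a⟩) (blockEquiv k h ⟨i, b⟩)
      exact ⟨P, fun A ↦ by rw [← hP, directSum_val, blockMatrix_apply_same]⟩
    · refine continuous_matrix fun a b ↦ ?_
      have := hφ.continuous.matrix_elem (blockEquiv k h ⟨i, a⟩) (blockEquiv k h ⟨i, b⟩)
      simpa only [directSum_val, blockMatrix_apply_same] using this
    · exact (isSemisimple_blockMatrix_iff h).1 (hφ.semisimple w) i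
  · intro hψ
    refine ⟨fun a b ↦ ?_, ?_, fun w ↦ ?_⟩
    · by_cases hab : blockIndex k h a = blockIndex k h b
      · obtain ⟨⟨i, a⟩, rfl⟩ := (blockEquiv k h).surjective a
        obtain ⟨⟨j, b⟩, rfl⟩ := (blockEquiv k h).surjective b
        simp only [blockIndex_blockEquiv] at hab
        subst hab
        obtain ⟨P, hP⟩ := (hψ i).rational a b
        exact ⟨P, fun A ↦ by rw [← hP, directSum_val, blockMatrix_apply_same]⟩
      · exact ⟨0, fun A ↦ by rw [directSum_val, blockMatrix_apply_ne h _ hab, map_zero]⟩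
    · refine continuous_matrix fun a b ↦ ?_
      by_cases hab : blockIndex k h a = blockIndex k h b
      · obtain ⟨⟨i, a⟩, rfl⟩ := (blockEquiv k h).surjective a
        obtain ⟨⟨j, b⟩, rfl⟩ := (blockEquiv k h).surjective b
        simp only [blockIndex_blockEquiv] at hab
        subst hab
        simpa only [directSum_val, blockMatrix_apply_same] using (hψ i).continuous.matrix_elem a b
      · simpa only [directSum_val, blockMatrix_apply_ne h _ hab] using continuous_const
    · exact (isSemisimple_blockMatrix_iff h).2 fun i ↦ (hψ i).semisimple w

/-- Extending an idempotent by zero to the other summands preserves idempotence, commutation and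
trace. -/
theorem IdempotentTracesDvd.of_directSum {G : Type*} [Group G] {d : ℕ}
    {ψ : ∀ i, G →* GL (Fin (k i)) ℂ} (hψ : IdempotentTracesDvd d (directSum h ψ)) (i : Fin r) :
    IdempotentTracesDvd d (ψ i) := by
  intro e he hc
  obtain ⟨t, ht⟩ := hψ (blockMatrix k h (Pi.single i e)) (by rw [← map_mul, ← Pi.single_mul, he])
    fun g ↦ by
      rw [directSum_val]
      refine Commute.map (Pi.commute_iff.2 fun j ↦ ?_) (blockMatrix k h)
      by_cases hj : j = i
      · subst hj
        rw [Pi.single_eq_same]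
        exact hc g
      · rw [Pi.single_eq_of_ne hj]
        exact Commute.zero_left _
  refine ⟨t, ?_⟩
  rw [← ht, trace_blockMatrix, Finset.sum_eq_single i, Pi.single_eq_same]
  · intro j _ hj
    rw [Pi.single_eq_of_ne hj, Matrix.trace_zero]
  · simp

/-- If all idempotents that commute with a direct sum are block diagonal, then the condition on
their ranks can be checked on the summands. -/
theorem IdempotentTracesDvd.directSum {G : Type*} [Group G] {d : ℕ}
    {ψ : ∀ i, G →* GL (Fin (k i)) ℂ} (hψ : ∀ i, IdempotentTracesDvd d (ψ i))
    (hblock : ∀ e : Matrix (Fin n) (Fin n) ℂ, (∀ g, Commute e (directSum h ψ g).val) →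
      ∀ i, Commute e (blockProj k h i)) : IdempotentTracesDvd d (directSum h ψ) := by
  intro e he hc
  obtain ⟨N, rfl⟩ := exists_eq_blockMatrix h (hblock e hc)
  rw [← map_mul] at he
  have he' := blockMatrix_injective h he
  have key : ∀ i, ∃ t : ℕ, (N i).trace = ((t * d : ℕ) : ℂ) := fun i ↦ by
    refine hψ i (N i) (congrFun he' i) fun g ↦ ?_
    have h1 := (hc g).eq
    rw [directSum_val, ← map_mul, ← map_mul] at h1
    exact congrFun (blockMatrix_injective h h1) i
  choose t ht using key
  refine ⟨∑ i, t i, ?_⟩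
  rw [trace_blockMatrix, Finset.sum_congr rfl fun i _ ↦ ht i, Finset.sum_mul, Nat.cast_sum]

end LHom

/-! ### Growth spaces of twisted direct sums -/

section GrowthOfSums

variable {F : Type*} [NontriviallyNormedField F] [IsUltrametricDist F] [LocallyCompactSpace F]
variable {n r : ℕ}

/-- The Weil group acts through a bounded set of matrices. -/
def IsBoundedOnWeil (φ : SL(2, ℂ) × WeilGroup F →* GL (Fin n) ℂ) : Prop :=
  ∃ C : ℝ, ∀ (w : WeilGroup F) (v : Fin n → ℂ), ‖(φ (1, w)).val.mulVec v‖ ≤ C * ‖v‖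

theorem isCompact_closure_weil_iff {φ : SL(2, ℂ) × WeilGroup F →* GL (Fin n) ℂ} :
    IsCompact (closure (Set.range fun w : WeilGroup F ↦ φ (1, w))) ↔ IsBoundedOnWeil φ :=
  isCompact_closure_range_iff (φ.comp (MonoidHom.inr SL(2, ℂ) (WeilGroup F)))

/-- In a growth space the constant depends on the vector; the finitely many basis vectors give a
uniform one. -/
theorem isBoundedOnWeil_iff {φ : SL(2, ℂ) × WeilGroup F →* GL (Fin n) ℂ} :
    IsBoundedOnWeil φ ↔ growthSpace φ 0 = ⊤ := by
  constructor
  · rintro ⟨C, hC⟩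
    refine eq_top_iff.2 fun v _ ↦ ⟨C * ‖v‖, fun w ↦ ?_⟩
    rw [Real.rpow_zero, mul_one]
    exact hC w v
  · intro h
    have h1 : ∀ b : Fin n, ∃ C : ℝ, ∀ w : WeilGroup F,
        ‖(φ (1, w)).val.mulVec (Pi.single b 1)‖ ≤ C := fun b ↦ by
      have h2 : (Pi.single b 1 : Fin n → ℂ) ∈ growthSpace φ 0 := by rw [h]; trivial
      simpa only [mem_growthSpace, Real.rpow_zero, mul_one] using h2
    choose C hC using h1
    refine ⟨n * ∑ b, |C b|, fun w ↦ norm_mulVec_le fun a b ↦ ?_⟩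
    have h3 := (norm_le_pi_norm _ a).trans (hC b w)
    rw [Matrix.mulVec_single_one] at h3
    exact (h3.trans (le_abs_self _)).trans (Finset.single_le_sum (f := fun b ↦ |C b|)
      (fun _ _ ↦ abs_nonneg _) (Finset.mem_univ b))

theorem mem_growthSpace_twist {φ : SL(2, ℂ) × WeilGroup F →* GL (Fin n) ℂ} {β γ : ℝ}
    {v : Fin n → ℂ} (hv : v ∈ growthSpace φ γ) :
    v ∈ growthSpace (twist φ (omega (β : ℂ))) (γ + β) := by
  obtain ⟨C, hC⟩ := hv
  refine ⟨C, fun w ↦ ?_⟩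
  rw [twist_val, Matrix.smul_mulVec, norm_smul, norm_omega, Real.rpow_add (weilNorm_pos w),
    mul_comm, ← mul_assoc]
  exact mul_le_mul_of_nonneg_right (hC w) (Real.rpow_nonneg (weilNorm_pos w).le _)

theorem twist_twist_neg (φ : SL(2, ℂ) × WeilGroup F →* GL (Fin n) ℂ) (s : ℂ) :
    twist (twist φ (omega s)) (omega (-s)) = φ := by
  ext1 g
  apply Units.ext
  rw [twist_val, twist_val, smul_smul, ← Units.val_mul, ← omega_add, neg_add_cancel, omega_zero,
    Units.val_one, one_smul]

theorem mem_growthSpace_twist_iff {φ : SL(2, ℂ) × WeilGroup F →* GL (Fin n) ℂ} {β γ : ℝ}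
    {v : Fin n → ℂ} :
    v ∈ growthSpace (twist φ (omega (β : ℂ))) γ ↔ v ∈ growthSpace φ (γ - β) := by
  constructor
  · intro hv
    have h1 := mem_growthSpace_twist (β := -β) hv
    rwa [Complex.ofReal_neg, twist_twist_neg] at h1
  · intro hv
    have h1 := mem_growthSpace_twist (β := β) hv
    rwa [sub_add_cancel] at h1

variable {k : Fin r → ℕ} (h : ∑ i, k i = n)

theorem mem_growthSpace_directSum_iff {ψ : ∀ i, SL(2, ℂ) × WeilGroup F →* GL (Fin (k i)) ℂ}
    {γ : ℝ} {v : Fin n → ℂ} :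
    v ∈ growthSpace (directSum h ψ) γ ↔
      ∀ i, (fun b ↦ v (blockEquiv k h ⟨i, b⟩)) ∈ growthSpace (ψ i) γ := by
  constructor
  · rintro ⟨C, hC⟩ i
    refine ⟨C, fun w ↦ ?_⟩
    rw [pi_norm_le_iff_of_nonneg ((norm_nonneg _).trans (hC w))]
    intro a
    have h1 := (norm_le_pi_norm _ (blockEquiv k h ⟨i, a⟩)).trans (hC w)
    rwa [directSum_val, blockMatrix_mulVec] at h1
  · intro hv
    choose C hC using hv
    have hnn : ∀ (w : WeilGroup F) i, 0 ≤ C i * weilNorm w ^ γ := fun w i ↦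
      (norm_nonneg _).trans (hC i w)
    refine ⟨∑ i, C i, fun w ↦ ?_⟩
    rw [Finset.sum_mul, pi_norm_le_iff_of_nonneg (Finset.sum_nonneg fun i _ ↦ hnn w i)]
    intro a
    obtain ⟨⟨i, a⟩, rfl⟩ := (blockEquiv k h).surjective a
    rw [directSum_val, blockMatrix_mulVec]
    exact ((norm_le_pi_norm _ a).trans (hC i w)).trans
      (Finset.single_le_sum (f := fun i ↦ C i * weilNorm w ^ γ) (fun i _ ↦ hnn w i)
        (Finset.mem_univ i))

theorem IsAdmissible.iSupIndep_growthSpace {φ : SL(2, ℂ) × WeilGroup F →* GL (Fin n) ℂ}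
    (hφ : IsAdmissible φ) : iSupIndep (growthSpace φ) :=
  LanglandsGL.iSupIndep_growthSpace (continuous_weil_iff.2 hφ.continuous) hφ.semisimple

theorem IsAdmissible.iSup_growthSpace {φ : SL(2, ℂ) × WeilGroup F →* GL (Fin n) ℂ}
    (hφ : IsAdmissible φ) : ⨆ β, growthSpace φ β = ⊤ :=
  LanglandsGL.iSup_growthSpace (continuous_weil_iff.2 hφ.continuous) hφ.semisimple

/-- The growth spaces are independent, and the one of exponent zero is everything. -/
theorem growthSpace_eq_bot {φ : SL(2, ℂ) × WeilGroup F →* GL (Fin n) ℂ} (hφ : IsAdmissible φ)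
    (hb : IsBoundedOnWeil φ) {γ : ℝ} (hγ : γ ≠ 0) : growthSpace φ γ = ⊥ := by
  have h1 := hφ.iSupIndep_growthSpace.pairwiseDisjoint hγ
  rw [Function.onFun, isBoundedOnWeil_iff.1 hb] at h1
  exact disjoint_top.1 h1

variable {ψ : ∀ i, SL(2, ℂ) × WeilGroup F →* GL (Fin (k i)) ℂ}

/-- The direct sum of the twists `ψ_i ω_{β_i}`. -/
def twistedSum (ψ : ∀ i, SL(2, ℂ) × WeilGroup F →* GL (Fin (k i)) ℂ) (β : Fin r → ℝ) :
    SL(2, ℂ) × WeilGroup F →* GL (Fin n) ℂ :=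
  directSum h fun i ↦ twist (ψ i) (omega (β i : ℂ))

theorem isAdmissible_twistedSum (ha : ∀ i, IsAdmissible (ψ i)) (β : Fin r → ℝ) :
    IsAdmissible (twistedSum h ψ β) :=
  (isAdmissible_directSum_iff h).2 fun i ↦ (ha i).twist _

/-- Nonzero vectors of the `i`-th twisted summand have growth exponent `β i` and no other, so the
growth spaces of the sum are coordinate subspaces. -/
theorem mem_growthSpace_twistedSum_iff (ha : ∀ i, IsAdmissible (ψ i))
    (hb : ∀ i, IsBoundedOnWeil (ψ i)) {β : Fin r → ℝ} {γ : ℝ} {v : Fin n → ℂ} :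
    v ∈ growthSpace (twistedSum h ψ β) γ ↔ ∀ a, v a ≠ 0 → β (blockIndex k h a) = γ := by
  rw [twistedSum, mem_growthSpace_directSum_iff]
  simp only [mem_growthSpace_twist_iff]
  constructor
  · intro hv a hva
    obtain ⟨⟨i, a⟩, rfl⟩ := (blockEquiv k h).surjective a
    rw [blockIndex_blockEquiv]
    by_contra hne
    have h1 := hv i
    rw [growthSpace_eq_bot (ha i) (hb i) (sub_ne_zero.2 (Ne.symm hne)), Submodule.mem_bot] at h1
    exact hva (congrFun h1 a)
  · intro hv i
    by_cases hi : β i = γ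
    · rw [hi, sub_self, isBoundedOnWeil_iff.1 (hb i)]
      trivial
    · convert zero_mem (growthSpace (ψ i) (γ - β i)) using 1
      funext b
      by_contra hne
      exact hi (by simpa using hv _ hne)

theorem single_mem_growthSpace_twistedSum (ha : ∀ i, IsAdmissible (ψ i))
    (hb : ∀ i, IsBoundedOnWeil (ψ i)) (β : Fin r → ℝ) (b : Fin n) :
    (Pi.single b 1 : Fin n → ℂ) ∈ growthSpace (twistedSum h ψ β) (β (blockIndex k h b)) := by
  rw [mem_growthSpace_twistedSum_iff h ha hb]
  intro a hne
  have : a = b := by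
    by_contra hab
    exact hne (Pi.single_eq_of_ne hab _)
  rw [this]

variable {r' : ℕ} {k' : Fin r' → ℕ} {h' : ∑ i, k' i = n}
  {ψ' : ∀ i, SL(2, ℂ) × WeilGroup F →* GL (Fin (k' i)) ℂ} {β : Fin r → ℝ} {β' : Fin r' → ℝ}

/-- A matrix that intertwines two twisted sums respects the exponents of the blocks. -/
theorem exponent_eq_of_intertwining (ha : ∀ i, IsAdmissible (ψ i))
    (hb : ∀ i, IsBoundedOnWeil (ψ i)) (ha' : ∀ i, IsAdmissible (ψ' i))
    (hb' : ∀ i, IsBoundedOnWeil (ψ' i)) {e : Matrix (Fin n) (Fin n) ℂ}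
    (he : ∀ g, e * (twistedSum h ψ β g).val = (twistedSum h' ψ' β' g).val * e) {a b : Fin n}
    (hab : e a b ≠ 0) : β' (blockIndex k' h' a) = β (blockIndex k h b) := by
  have h1 := mulVec_mem_growthSpace (twistedSum h' ψ' β') (fun w ↦ he (1, w))
    (single_mem_growthSpace_twistedSum h ha hb β b)
  rw [mem_growthSpace_twistedSum_iff h' ha' hb'] at h1
  exact h1 a (by rwa [Matrix.mulVec_single_one])

/-- Because the exponents are distinct, a matrix commuting with the sum cannot mix blocks. -/
theorem idempotentTracesDvd_twistedSum {d : ℕ} (hβ : Function.Injective β)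
    (ha : ∀ i, IsAdmissible (ψ i)) (hb : ∀ i, IsBoundedOnWeil (ψ i))
    (hd : ∀ i, IdempotentTracesDvd d (ψ i)) : IdempotentTracesDvd d (twistedSum h ψ β) := by
  refine IdempotentTracesDvd.directSum h (fun i ↦ (hd i).twist _) fun e he ↦ ?_
  rw [commute_blockProj_iff]
  intro a b hab
  by_contra hne
  exact hab (hβ (exponent_eq_of_intertwining h (h' := h) ha hb ha hb (fun g ↦ (he g).eq) hne))

theorem range_exponent_subset (hk : ∀ i, 1 ≤ k i) (ha : ∀ i, IsAdmissible (ψ i))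
    (hb : ∀ i, IsBoundedOnWeil (ψ i)) (ha' : ∀ i, IsAdmissible (ψ' i))
    (hb' : ∀ i, IsBoundedOnWeil (ψ' i)) {x : GL (Fin n) ℂ}
    (hx : ∀ g, x.val * (twistedSum h ψ β g).val = (twistedSum h' ψ' β' g).val * x.val) :
    Set.range β ⊆ Set.range β' := by
  rintro _ ⟨i, rfl⟩
  -- A column in the `i`-th block; as `x` is invertible, it has a nonzero entry.
  let b := blockEquiv k h ⟨i, ⟨0, hk i⟩⟩
  have h0 : ∃ a, x.val a b ≠ 0 := by
    by_contra! hc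
    have h1 : (x⁻¹.val * x.val) b b = 0 := by
      rw [Matrix.mul_apply]
      exact Finset.sum_eq_zero fun a _ ↦ by rw [hc, mul_zero]
    simp at h1
  obtain ⟨a, hab⟩ := h0
  refine ⟨blockIndex k' h' a, ?_⟩
  rw [exponent_eq_of_intertwining h (h' := h') ha hb ha' hb' hx hab, blockIndex_blockEquiv]

theorem intertwining_symm {G : Type*} [Group G] {φ φ' : G →* GL (Fin n) ℂ} {x : GL (Fin n) ℂ}
    (hx : ∀ g, φ' g = x * φ g * x⁻¹) :
    (∀ g, x.val * (φ g).val = (φ' g).val * x.val) ∧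
      ∀ g, (x⁻¹).val * (φ' g).val = (φ g).val * (x⁻¹).val := by
  simp only [← Units.val_mul, hx]
  constructor <;> intro g <;> congr 1 <;> group

end GrowthOfSums

/-! ### Conjugate twisted sums with the same exponents -/

section SameExponents

variable {F : Type*} [NontriviallyNormedField F] [IsUltrametricDist F] [LocallyCompactSpace F]
variable {n r : ℕ} {k k' : Fin r → ℕ} {h : ∑ i, k i = n} {h' : ∑ i, k' i = n}
  {ψ : ∀ i, SL(2, ℂ) × WeilGroup F →* GL (Fin (k i)) ℂ}
  {ψ' : ∀ i, SL(2, ℂ) × WeilGroup F →* GL (Fin (k' i)) ℂ} {β : Fin r → ℝ}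

/-- The matrix `x` conjugates the block projections of one sum to those of the other, and their
traces are the block sizes. -/
theorem sizes_eq_of_conj (hβ : Function.Injective β) (ha : ∀ i, IsAdmissible (ψ i))
    (hb : ∀ i, IsBoundedOnWeil (ψ i)) (ha' : ∀ i, IsAdmissible (ψ' i))
    (hb' : ∀ i, IsBoundedOnWeil (ψ' i)) {x : GL (Fin n) ℂ}
    (hx : ∀ g, twistedSum h' ψ' β g = x * twistedSum h ψ β g * x⁻¹) : k = k' := by
  funext i
  have h1 : x.val * blockProj k h i = blockProj k' h' i * x.val := by
    ext a b
    simp only [blockProj, Matrix.mul_diagonal, Matrix.diagonal_mul]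
    by_cases hab : x.val a b = 0
    · simp [hab]
    · rw [hβ (exponent_eq_of_intertwining h (h' := h') ha hb ha' hb' (intertwining_symm hx).1 hab),
        mul_comm]
  have h2 : x.val * blockProj k h i * (x⁻¹).val = blockProj k' h' i := by
    rw [h1, mul_assoc, Units.mul_inv, mul_one]
  have h3 := congrArg Matrix.trace h2
  rw [trace_conj, trace_blockProj, trace_blockProj] at h3
  exact_mod_cast h3

/-- Respecting distinct exponents forces `x` to be block diagonal; its blocks conjugate the twisted
summands, and the scalar twists cancel. -/
theorem summands_conj_of_conj {ψ' : ∀ i, SL(2, ℂ) × WeilGroup F →* GL (Fin (k i)) ℂ}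
    (hβ : Function.Injective β) (ha : ∀ i, IsAdmissible (ψ i))
    (hb : ∀ i, IsBoundedOnWeil (ψ i)) (ha' : ∀ i, IsAdmissible (ψ' i))
    (hb' : ∀ i, IsBoundedOnWeil (ψ' i)) {x : GL (Fin n) ℂ}
    (hx : ∀ g, twistedSum h ψ' β g = x * twistedSum h ψ β g * x⁻¹) (i : Fin r) :
    ∃ y : GL (Fin (k i)) ℂ, ∀ g, ψ' i g = y * ψ i g * y⁻¹ := by
  have h1 : x ∈ standardLevi k h := by
    rw [mem_standardLevi_iff]
    intro a b hab
    by_contra hne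
    exact hab (hβ (exponent_eq_of_intertwining h (h' := h) ha hb ha' hb'
      (intertwining_symm hx).1 hne))
  obtain ⟨y, rfl⟩ := h1
  refine ⟨y i, fun g ↦ ?_⟩
  have h2 := hx g
  simp only [twistedSum, directSum, MonoidHom.comp_apply, ← map_inv, ← map_mul] at h2
  have h3 := congrFun (blockDiag_injective k h h2) i
  simp only [MonoidHom.pi_apply, Pi.mul_apply, Pi.inv_apply] at h3
  have h4 := congrArg Units.val h3
  rw [Units.val_mul, Units.val_mul, twist_val, twist_val, Matrix.mul_smul, Matrix.smul_mul] at h4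
  exact Units.ext (smul_right_injective _ (Units.ne_zero _) h4)

end SameExponents

/-! ### Existence of the decomposition by growth -/

section Decomposition

variable {F : Type*} [NontriviallyNormedField F] [IsUltrametricDist F] [LocallyCompactSpace F]
variable {n : ℕ}

theorem exists_eq_directSum {G : Type*} [Group G] {r : ℕ} {k : Fin r → ℕ} (h : ∑ i, k i = n)
    (φ : G →* GL (Fin n) ℂ) (hφ : ∀ g, φ g ∈ standardLevi k h) :
    ∃ ψ : ∀ i, G →* GL (Fin (k i)) ℂ, φ = directSum h ψ := by
  let f : G →* ∀ i, GL (Fin (k i)) ℂ :=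
    (MonoidHom.ofInjective (blockDiag_injective k h)).symm.toMonoidHom.comp
      (φ.codRestrict (blockDiag k h).range hφ)
  refine ⟨fun i ↦ (Pi.evalMonoidHom _ i).comp f, ?_⟩
  ext1 g
  exact (MonoidHom.apply_ofInjective_symm (blockDiag_injective k h) ⟨φ g, hφ g⟩).symm

/-- The decomposition of a homomorphism according to the growth on the Weil group. -/
theorem exists_conj_twistedSum {φ : SL(2, ℂ) × WeilGroup F →* GL (Fin n) ℂ}
    (hφ : IsAdmissible φ) :
    ∃ (r : ℕ) (k : Fin r → ℕ) (h : ∑ i, k i = n) (β : Fin r → ℝ) (x : GL (Fin n) ℂ)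
      (ψ : ∀ i, SL(2, ℂ) × WeilGroup F →* GL (Fin (k i)) ℂ),
      StrictAnti β ∧ (∀ i, 1 ≤ k i) ∧ (∀ i, IsBoundedOnWeil (ψ i)) ∧
        conjHom x φ = twistedSum h ψ β := by
  -- Only finitely many exponents occur, since the growth spaces are independent in finite
  -- dimension.
  have hfin := WellFoundedGT.finite_ne_bot_of_iSupIndep hφ.iSupIndep_growthSpace
  let s := hfin.toFinset
  -- The enumeration `orderEmbOfFin` is increasing; reversing the index makes the exponents
  -- decrease.
  let β : Fin s.card → ℝ := fun i ↦ s.orderEmbOfFin rfl i.rev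
  have hβ : StrictAnti β := fun i j hij ↦ (s.orderEmbOfFin rfl).strictMono (Fin.rev_lt_rev.2 hij)
  have hmem : ∀ i, growthSpace φ (β i) ≠ ⊥ := fun i ↦
    hfin.mem_toFinset.1 (s.orderEmbOfFin_mem rfl i.rev)
  let V : Fin s.card → Submodule ℂ (Fin n → ℂ) := fun i ↦ growthSpace φ (β i)
  have hV : DirectSum.IsInternal V := by
    refine DirectSum.isInternal_submodule_of_iSupIndep_of_iSup_eq_top
      (hφ.iSupIndep_growthSpace.comp hβ.injective) (eq_top_iff.2 ?_)
    rw [← hφ.iSup_growthSpace]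
    refine iSup_le fun γ ↦ ?_
    by_cases hγ : growthSpace φ γ = ⊥
    · rw [hγ]
      exact bot_le
    · have h1 : γ ∈ Set.range (s.orderEmbOfFin rfl) := by
        rw [Finset.range_orderEmbOfFin]
        exact hfin.mem_toFinset.2 hγ
      obtain ⟨i, rfl⟩ := h1
      refine le_iSup_of_le i.rev (le_of_eq ?_)
      simp only [V, β, Fin.rev_rev]
  obtain ⟨h, x, hx⟩ := exists_adapted_basis (fun i ↦ Module.finrank ℂ (V i)) hV fun _ ↦ rfl
  obtain ⟨ψ, hψ⟩ := exists_eq_directSum h (conjHom x⁻¹ φ) fun g ↦ by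
    rw [conjHom_apply, inv_inv]
    exact conj_mem_standardLevi_of_invariant _ h hx fun i v hv ↦ growthSpace_invariant g hv
  have htw : ∀ i, twist (twist (ψ i) (omega ((-β i : ℝ) : ℂ))) (omega (β i : ℂ)) = ψ i := fun i ↦ by
    have h1 := twist_twist_neg (ψ i) (-(β i : ℂ))
    rwa [neg_neg, ← Complex.ofReal_neg] at h1
  -- Twisting the `i`-th block by `-β i` moves its growth exponent to zero, which is boundedness.
  refine ⟨s.card, _, h, β, x⁻¹, fun i ↦ twist (ψ i) (omega ((-β i : ℝ) : ℂ)), hβ,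
    fun i ↦ Nat.one_le_iff_ne_zero.2 fun h0 ↦ hmem i (Submodule.finrank_eq_zero.1 h0),
    fun i ↦ ?_, ?_⟩
  · rw [isBoundedOnWeil_iff, eq_top_iff]
    intro v _
    rw [mem_growthSpace_twist_iff, sub_neg_eq_add, zero_add]
    -- The vector `v` placed in the `i`-th block and extended by zero.
    let u : Fin n → ℂ := fun a ↦
      (Pi.single i v : ∀ j, Fin (Module.finrank ℂ (V j)) → ℂ) ((blockEquiv _ h).symm a).1
        ((blockEquiv _ h).symm a).2
    have hu : u ∈ growthSpace (directSum h ψ) (β i) := by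
      rw [← hψ]
      have h1 : x.val.mulVec u ∈ growthSpace φ (β i) := by
        refine (hx i u).2 fun a hne ↦ ?_
        simp only [u]
        exact congrFun (Pi.single_eq_of_ne
          (M := fun j ↦ Fin (Module.finrank ℂ (V j)) → ℂ) hne v) _
      have h2 := mulVec_mem_growthSpace (e := (x⁻¹).val) (conjHom x⁻¹ φ) (fun w ↦ by
        rw [conjHom_val, mul_assoc, inv_inv, Units.mul_inv, mul_one]) h1
      rw [Matrix.mulVec_mulVec, Units.inv_mul, Matrix.one_mulVec] at h2
      exact h2
    have h3 := (mem_growthSpace_directSum_iff h).1 hu i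
    convert h3 using 1
    funext b
    simp only [u]
    rw [Equiv.symm_apply_apply, Pi.single_eq_same]
  · rw [hψ, twistedSum]
    congr 1
    funext i
    exact (htw i).symm

end Decomposition

/-! ### The bijection between tuples and L-parameters -/

section Classification

variable {F : Type*} [NontriviallyNormedField F] [IsUltrametricDist F] [LocallyCompactSpace F]
variable {D : Type*} [DivisionRing D] [Algebra F D]
variable {m : ℕ}

theorem LHom.isTempered_iff {φ : LHom F D m} : φ.IsTempered ↔ IsBoundedOnWeil φ.1 :=
  isCompact_closure_weil_iff

theorem LHom.isTempered_of_toParameter {φ : LHom F D m} {p : LParameter F D m}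
    (h : φ.toParameter = p) (hp : p.IsTempered) : IsBoundedOnWeil φ.1 := by
  subst h
  exact LHom.isTempered_iff.1 hp

theorem twistedBlockSum_eq (T : LanglandsTuple F D m) (φ : ∀ i, LHom F D (T.size i)) :
    twistedBlockSum T φ = twistedSum (sum_mul_eq T.size_sum _) (fun i ↦ (φ i).1) T.exponent := rfl

theorem isLHom_twistedBlockSum (hd : 0 < index F D) (T : LanglandsTuple F D m)
    (φ : ∀ i, LHom F D (T.size i)) (hφ : ∀ i, (φ i).toParameter = T.param i) :
    IsLHom D m (twistedBlockSum T φ) := by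
  have hL : ∀ i, _ := fun i ↦ (isLHom_iff hd).1 (φ i).2
  rw [isLHom_iff hd, twistedBlockSum_eq]
  exact ⟨isAdmissible_twistedSum _ (fun i ↦ (hL i).1) _,
    idempotentTracesDvd_twistedSum _ T.exponent_anti.injective (fun i ↦ (hL i).1)
      (fun i ↦ LHom.isTempered_of_toParameter (hφ i) (T.tempered i)) fun i ↦ (hL i).2⟩

/-- The class of the block diagonal homomorphism does not depend on the representatives. -/
theorem twistedBlockSum_conj (T : LanglandsTuple F D m) (φ φ' : ∀ i, LHom F D (T.size i))
    (hφ : ∀ i, (φ i).toParameter = (φ' i).toParameter) :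
    ∃ x, ∀ g, twistedBlockSum T φ' g = x * twistedBlockSum T φ g * x⁻¹ := by
  have h1 : ∀ i, φ i ≈ φ' i := fun i ↦ Quotient.exact (hφ i)
  choose y hy using h1
  refine ⟨blockDiag _ (sum_mul_eq T.size_sum _) y, fun g ↦ ?_⟩
  simp only [twistedBlockSum, MonoidHom.comp_apply, ← map_inv, ← map_mul]
  congr 1
  funext i
  simp only [MonoidHom.pi_apply, Pi.mul_apply, Pi.inv_apply]
  apply Units.ext
  rw [Units.val_mul, Units.val_mul, twist_val, twist_val, hy i g, Matrix.mul_smul,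
    Matrix.smul_mul]
  rfl

/-- Both tuples have the same set of exponents, and its strictly decreasing enumeration is unique.
This settles length and exponents first; only then can sizes, and after them parameters, be
compared, because of their dependent types. -/
theorem langlandsTuple_eq_of_conj (hd : 0 < index F D) (T T' : LanglandsTuple F D m)
    (φ : ∀ i, LHom F D (T.size i)) (φ' : ∀ i, LHom F D (T'.size i))
    (hφ : ∀ i, (φ i).toParameter = T.param i) (hφ' : ∀ i, (φ' i).toParameter = T'.param i)
    {x : GL (Fin (m * index F D)) ℂ}
    (hx : ∀ g, twistedBlockSum T' φ' g = x * twistedBlockSum T φ g * x⁻¹) : T = T' := by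
  have ha : ∀ i, IsAdmissible (φ i).1 := fun i ↦ ((isLHom_iff hd).1 (φ i).2).1
  have ha' : ∀ i, IsAdmissible (φ' i).1 := fun i ↦ ((isLHom_iff hd).1 (φ' i).2).1
  have hb := fun i ↦ LHom.isTempered_of_toParameter (hφ i) (T.tempered i)
  have hb' := fun i ↦ LHom.isTempered_of_toParameter (hφ' i) (T'.tempered i)
  simp only [twistedBlockSum_eq] at hx
  have hpos : ∀ (T : LanglandsTuple F D m) i, 1 ≤ T.size i * index F D := fun T i ↦
    Nat.mul_pos (T.size_pos i) hd
  have hrange : Set.range T.exponent = Set.range T'.exponent :=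
    (range_exponent_subset _ (hpos T) ha hb ha' hb' (intertwining_symm hx).1).antisymm
      (range_exponent_subset _ (hpos T') ha' hb' ha hb (intertwining_symm hx).2)
  obtain ⟨r, c, hc1, hc, p, hp, β, hβ⟩ := T
  obtain ⟨r', c', hc1', hc', p', hp', β', hβ'⟩ := T'
  obtain rfl : r = r' := by
    have h1 := congrArg Set.ncard hrange
    simpa [Set.ncard_range_of_injective hβ.injective,
      Set.ncard_range_of_injective hβ'.injective] using h1
  obtain rfl : β = β' := (StrictAnti.range_inj hβ hβ').1 hrange
  obtain rfl : c = c' := by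
    have h1 := sizes_eq_of_conj hβ.injective ha hb ha' hb' hx
    funext i
    exact Nat.eq_of_mul_eq_mul_right hd (congrFun h1 i)
  obtain rfl : p = p' := by
    funext i
    refine (hφ i).symm.trans (Eq.trans ?_ (hφ' i))
    exact Quotient.sound (summands_conj_of_conj hβ.injective ha hb ha' hb' hx i)
  rfl

theorem exists_langlandsTuple (hd : 0 < index F D) (φ : LHom F D m) :
    ∃ (T : LanglandsTuple F D m) (φ' : ∀ i, LHom F D (T.size i)) (x : GL _ ℂ),
      (∀ i, (φ' i).toParameter = T.param i) ∧
        ∀ g, φ.1 g = x * twistedBlockSum T φ' g * x⁻¹ := by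
  obtain ⟨ha, hdvd⟩ := (isLHom_iff hd).1 φ.2
  obtain ⟨r, k, h, β, x, ψ, hβ, hk, hb, hx⟩ := exists_conj_twistedSum ha
  have ha' := ha.conjHom x
  have hdvd' := hdvd.conjHom x
  rw [hx] at ha' hdvd'
  have hψa : ∀ i, IsAdmissible (ψ i) := fun i ↦ by
    have h1 := ((isAdmissible_directSum_iff h).1 ha' i).twist (-(β i : ℂ))
    rwa [twist_twist_neg] at h1
  have hψd : ∀ i, IdempotentTracesDvd (index F D) (ψ i) := fun i ↦ by
    have h1 := (hdvd'.of_directSum h i).twist (omega (-(β i : ℂ)))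
    rwa [twist_twist_neg] at h1
  -- The identity is a commuting idempotent of trace `k i`, so `d` divides the block size.
  have hdk : ∀ i, ∃ c, k i = c * index F D := fun i ↦ by
    obtain ⟨t, ht⟩ := hψd i 1 (mul_one 1) fun g ↦ Commute.one_left _
    refine ⟨t, ?_⟩
    rw [Matrix.trace_one, Fintype.card_fin] at ht
    exact_mod_cast ht
  choose c hc using hdk
  obtain rfl : k = fun i ↦ c i * index F D := funext hc
  have hL : ∀ i, IsLHom D (c i) (ψ i) := fun i ↦ (isLHom_iff hd).2 ⟨hψa i, hψd i⟩
  let φ' : ∀ i, LHom F D (c i) := fun i ↦ ⟨ψ i, hL i⟩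
  have hsum : ∑ i, c i = m := by
    rw [← Finset.sum_mul] at h
    exact Nat.eq_of_mul_eq_mul_right hd h
  let T : LanglandsTuple F D m :=
    { length := r
      size := c
      size_pos := fun i ↦ Nat.pos_of_mul_pos_right (hk i)
      size_sum := hsum
      param := fun i ↦ (φ' i).toParameter
      tempered := fun i ↦ LHom.isTempered_iff.2 (hb i)
      exponent := β
      exponent_anti := hβ }
  refine ⟨T, φ', x⁻¹, fun i ↦ rfl, fun g ↦ ?_⟩
  have h1 : twistedBlockSum T φ' = conjHom x φ.1 := hx.symm
  rw [h1, conjHom_apply]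
  group

variable (F D m) in
theorem exists_equiv_langlandsTuple (hd : 0 < index F D) :
    ∃ e : LanglandsTuple F D m ≃ LParameter F D m,
      ∀ (T : LanglandsTuple F D m) (φ : ∀ i, LHom F D (T.size i)),
        (∀ i, (φ i).toParameter = T.param i) →
        ∃ h : IsLHom D m (twistedBlockSum T φ),
          e T = LHom.toParameter ⟨twistedBlockSum T φ, h⟩ := by
  have hrep : ∀ (T : LanglandsTuple F D m) i, LHom.toParameter (T.param i).out = T.param i :=
    fun T i ↦ Quotient.out_eq _
  -- The map uses chosen representatives; `hf` shows that the choice is immaterial.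
  let f : LanglandsTuple F D m → LParameter F D m := fun T ↦
    LHom.toParameter ⟨twistedBlockSum T fun i ↦ (T.param i).out,
      isLHom_twistedBlockSum hd T _ (hrep T)⟩
  have hf : ∀ (T : LanglandsTuple F D m) (φ : ∀ i, LHom F D (T.size i))
      (hφ : ∀ i, (φ i).toParameter = T.param i),
      f T = LHom.toParameter ⟨twistedBlockSum T φ, isLHom_twistedBlockSum hd T φ hφ⟩ :=
    fun T φ hφ ↦ Quotient.sound
      (twistedBlockSum_conj T _ φ fun i ↦ (hrep T i).trans (hφ i).symm)
  have hinj : Function.Injective f := fun T T' hTT' ↦ by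
    obtain ⟨x, hx⟩ := Quotient.exact hTT'
    exact langlandsTuple_eq_of_conj hd T T' _ _ (hrep T) (hrep T') hx
  have hsurj : Function.Surjective f := fun p ↦ by
    obtain ⟨φ, rfl⟩ := Quotient.exists_rep p
    obtain ⟨T, φ', x, hφ', hx⟩ := exists_langlandsTuple hd φ
    exact ⟨T, (hf T φ' hφ').trans (Quotient.sound ⟨x, hx⟩)⟩
  exact ⟨Equiv.ofBijective f ⟨hinj, hsurj⟩, fun T φ hφ ↦ ⟨_, hf T φ hφ⟩⟩

end Classification

end LanglandsGL

end


theorem mainTheorem11 (F : Type*) [NontriviallyNormedField F] [IsUltrametricDist F]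
    [LocallyCompactSpace F] (D : Type*) [DivisionRing D] [Algebra F D] [Algebra.IsCentral F D]
    [FiniteDimensional F D] (m : ℕ) (hm : 1 ≤ m) :
    (∃ e : LanglandsGL.LanglandsTuple F D m ≃ LanglandsGL.LParameter F D m,
      ∀ (T : LanglandsGL.LanglandsTuple F D m)
        (φ : ∀ i, LanglandsGL.LHom F D (T.size i)),
        (∀ i, (φ i).toParameter = T.param i) →
        ∃ h : LanglandsGL.IsLHom D m (LanglandsGL.twistedBlockSum T φ),
          e T = LanglandsGL.LHom.toParameter ⟨LanglandsGL.twistedBlockSum T φ, h⟩) ∧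
    (∀ (r : ℕ) (k : Fin r → ℕ) (hk : ∀ i, 1 ≤ k i)
      (h : ∑ i, k i = m * LanglandsGL.index F D),
      LanglandsGL.IsRelevantLevi F D m (LanglandsGL.standardLevi k h) ↔
        ∀ i, LanglandsGL.index F D ∣ k i) :=
  ⟨LanglandsGL.exists_equiv_langlandsTuple F D m (LanglandsGL.index_pos F D),
    fun _ _ hk h ↦ LanglandsGL.isRelevantLevi_standardLevi_iff F D hk h⟩
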